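/- Let $d\ge 3$, let $K$ be a number field of degree $k=[K:\mathbb Q]$ with ring of integers $\mathfrak o$, let $\mathcal P_K$ be the set of nonzero primes $\mathfrak p$ of $\mathfrak o$, $N\mathfrak p=|\mathfrak o/\mathfrak p|$, $\mathfrak o_{\mathfrak p}$ the completed local ring with normalized Haar measure $\nu_{\mathfrak p}$ (on $\mathfrak o_{\mathfrak p}^m$), and $k_\infty=\mathfrak o\otimes_{\mathbb Z}\mathbb R$. For an integral basis $\mathbb E=(e_1,\dots,e_k)$ of $\mathfrak o$ put $O(H,\mathbb E)=\{\sum a_je_j: a_j\in\mathbb Z\cap[-H,H)\}$; the (upper) density of $T\subseteq\mathfrak o^{m}$ with respect to $\mathbb E$ is the limit (superior) of $|T\cap O(H,\mathbb E)^m|/(2H)^{km}$ as $H\to\infty$. Identify $a=(a_0,\dots,a_d)$ with $f=\sum a_ix^i$ and let $\sigma_b f(x)=f(x+b)$. Call $f\in\mathfrak o^{d+1}$ $\mathfrak p$-Eisenstein if $a_d\notin\mathfrak p$, $a_0\notin\mathfrak p^2$ and $a_i\in\mathfrak p$ for $i<d$. Let $\widetilde\Gamma^d\subseteq \mathfrak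 o^{d+1}$ be the set of shifted Eisenstein polynomials, i.e. of all $f$ such that $f(x+b)$ is $\mathfrak p$-Eisenstein for some $\mathfrak p\in\mathcal P_K$ and $b\in\mathfrak o$. Put $U_{\mathfrak p}=(\mathfrak p\mathfrak o_{\mathfrak p}\setminus\mathfrak p^2\mathfrak o_{\mathfrak p})\times(\mathfrak p\mathfrak o_{\mathfrak p})^{d-1}\times(\mathfrak o_{\mathfrak p}\setminus\mathfrak p\mathfrak o_{\mathfrak p})$, $\widetilde U_{\mathfrak p}=\bigcup_{b+\mathfrak p\in\mathfrak o/\mathfrak p}\sigma_b^{-1}(U_{\mathfrak p})$ and $\widetilde U_\infty=\emptyset\subseteq k_\infty^{d+1}$. For $a\in\mathfrak o^{d+1}$ let $X(a)$ be the number of $\eta\in\mathcal P_K\cup\{\infty\}$ with $a\in\widetilde U_\eta$, let $I=\{a: X(a)=\infty\}$, and let $B_H=O(H,\mathbb E)^{d+1}\setminus I$. **(a)** $\sigma_b^{-1}(U_{\mathfrak p})$ depends only on $b+\mathfrak p$, and the union defining $\widetilde U_{\mathfrak p}$ is disjoint. **(b)** For every $\mathbb E$, the system $(\widetilde U_\eta)$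 corresponds to $\widetilde\Gamma^d$: the tail condition below holds, and $a\notin\widetilde\Gamma^d$ if and only if $a$ lies in no $\widetilde U_\eta$. **(c)** For every $\mathbb E$ and every $n\ge1$ the system satisfies the hypotheses of the local-to-global principle for the $n$-th moment, namely: - $\nu_{\mathfrak p}(\partial\widetilde U_{\mathfrak p})=0$ for all $\mathfrak p$, $\partial\widetilde U_\infty$ has Lebesgue measure $0$, and $\mathbb R_{\ge0}\cdot\widetilde U_\infty=\widetilde U_\infty$; - (tail condition) the upper density of the set of $a\in\mathfrak o^{d+1}$ that lie in $\widetilde U_{\mathfrak p}$ for some $\mathfrak p$ above a rational prime $p>M$ tends to $0$ as $M\to\infty$; - there are a real $\alpha\ge0$ and integers $c',c$ such that for all integers $H\ge1$ and all $a\in B_H$, fewer than $c$ primes $\mathfrak p$ above a rational prime $p>c'H^\alpha$ satisfy $a\in\widetilde U_{\mathfrak p}$; and there is a family of real numbers $(v_{\mathfrak p})_{\mathfrak p\in\mathcal P_K}$, independent of $H$, with $\sum_{\mathfrak p}v_{\mathfrak p}$ convergent, such that for all integers $H\ge1$, all $1\le r\le n$ and all pairwise distinct $\mathfrak p_1,\dots,\mathfrak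 p_r$ above rational primes $\le c'H^\alpha$, $$\Big|B_H\cap\bigcap_{j=1}^r\widetilde U_{\mathfrak p_j}\Big|\le(2H)^{k(d+1)}\prod_{j=1}^r v_{\mathfrak p_j}.$$ **(d)** Put $s_{\mathfrak p}=\dfrac{(N\mathfrak p-1)^2}{N\mathfrak p^{\,d+1}}$. The series $\sum s_{\mathfrak p}$, $\sum s_{\mathfrak p}^2$ and the product $\prod(1-s_{\mathfrak p})$ over $\mathcal P_K$ converge. With $$\rho=1-\prod_{\mathfrak p\in\mathcal P_K}(1-s_{\mathfrak p})>0,\qquad \mu=\sum_{\mathfrak p\in\mathcal P_K}s_{\mathfrak p},\qquad \mu_{\widetilde\Gamma^d}=\rho^{-1}\mu,$$ for every integral basis $\mathbb E$ the following limits exist and have the stated values: the density of $\widetilde\Gamma^d$ is $\rho$; the mean number of primes is $\lim_H (2H)^{-k(d+1)}\sum_{a\in B_H}X(a)=\mu$; the restricted mean is $\lim_H |B_H\cap\widetilde\Gamma^d|^{-1}\sum_{a\in B_H\cap\widetilde\Gamma^d}X(a)=\mu_{\widetilde\Gamma^d}$; and the restricted variance is $$\lim_{H\to\infty}\frac{\sum_{a\in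 B_H\cap\widetilde\Gamma^d}\big(X(a)-\mu_{\widetilde\Gamma^d}\big)^2}{|O(H,\mathbb E)^{d+1}\cap\widetilde\Gamma^d|}=\frac1\rho\Big(\mu^2-\sum_{\mathfrak p\in\mathcal P_K}s_{\mathfrak p}^2+\mu\Big)-\frac{2\mu_{\widetilde\Gamma^d}}{\rho}\,\mu+\mu_{\widetilde\Gamma^d}^2 .$$ -/

import Mathlib

open NumberField IsDedekindDomain Polynomial Filter Topology
open scoped WithZero Pointwise Classical

noncomputable section

namespace LocalToGlobal

/-! ### Local integers and their Haar measure -/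

/-- The ring of integers is dense in its completion at `v`, to first order. -/
theorem exists_algebraMap_sub_lt_one (K : Type*) [Field K] [NumberField K]
    (v : HeightOneSpectrum (𝓞 K)) (x : v.adicCompletionIntegers K) :
    ∃ a : 𝓞 K, Valued.v (((algebraMap (𝓞 K) (v.adicCompletionIntegers K) a - x :
      v.adicCompletionIntegers K) : v.adicCompletion K)) < (1 : ℤᵐ⁰) := by
  have ho : IsOpen {y : v.adicCompletion K | Valued.v (y - x) < (1 : ℤᵐ⁰)} := by
    have h1 : IsOpen {y : v.adicCompletion K | Valued.v y < (1 : ℤᵐ⁰)} := by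
      have := Valued.isOpen_ball (v.adicCompletion K) (Γ₀ := ℤᵐ⁰) 1
      simpa [Valuation.restrict_lt_one_iff] using this
    exact h1.preimage (continuous_id.sub continuous_const)
  obtain ⟨k, hk⟩ := (HeightOneSpectrum.denseRange_algebraMap K v).exists_mem_open ho
    ⟨(x : v.adicCompletion K), by simp⟩
  have hk1 : v.valuation K k ≤ 1 := by
    rw [← HeightOneSpectrum.valuedAdicCompletion_eq_valuation']
    have : ((k : K) : v.adicCompletion K) = (algebraMap K (v.adicCompletion K) k - x) + x := by
      rw [sub_add_cancel]; rfl
    rw [this]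
    exact (Valued.v.map_add _ _).trans (max_le hk.le x.2)
  obtain ⟨a, ha⟩ := v.exists_valuation_sub_lt_of_integer (K := K) hk1 1
  refine ⟨a, ?_⟩
  have e : (((algebraMap (𝓞 K) (v.adicCompletionIntegers K) a - x :
      v.adicCompletionIntegers K) : v.adicCompletion K)) =
      algebraMap K (v.adicCompletion K) (algebraMap (𝓞 K) K a - k) +
        (algebraMap K (v.adicCompletion K) k - x) := by
    rw [map_sub]; simp; rfl
  rw [e]
  refine (Valued.v.map_add _ _).trans_lt (max_lt ?_ hk)
  have := HeightOneSpectrum.valuedAdicCompletion_eq_valuation' v (algebraMap (𝓞 K) K a - k)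
  rw [← this] at ha
  exact ha

/-- The ring of integers of the completion of a number field at a finite place is compact. -/
instance compactSpace_adicCompletionIntegers (K : Type*) [Field K] [NumberField K]
    (v : HeightOneSpectrum (𝓞 K)) : CompactSpace (v.adicCompletionIntegers K) := by
  have : CompactSpace (Valued.integer (v.adicCompletion K)) := by
    rw [Valued.integer.compactSpace_iff_completeSpace_and_isDiscreteValuationRing_and_finite_residueField]
    refine ⟨?_, ?_, ?_⟩
    · exact (Valued.isClosed_integer (v.adicCompletion K)).completeSpace_coe
    · exact inferInstanceAs (IsDiscreteValuationRing (v.adicCompletionIntegers K))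
    · have hfin : Finite (𝓞 K ⧸ v.asIdeal) := Ideal.finiteQuotientOfFreeOfNeBot _ v.ne_bot
      let g : 𝓞 K → Valued.integer (v.adicCompletion K) := fun r =>
        ⟨(algebraMap (𝓞 K) (v.adicCompletionIntegers K) r : v.adicCompletionIntegers K),
          (algebraMap (𝓞 K) (v.adicCompletionIntegers K) r).2⟩
      refine Finite.of_surjective (fun q : 𝓞 K ⧸ v.asIdeal =>
        IsLocalRing.residue (Valued.integer (v.adicCompletion K)) (g q.out)) ?_
      intro y
      obtain ⟨x, rfl⟩ := IsLocalRing.residue_surjective y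
      let x' : v.adicCompletionIntegers K := ⟨x, x.2⟩
      obtain ⟨a, ha⟩ := exists_algebraMap_sub_lt_one K v x'
      refine ⟨Ideal.Quotient.mk _ a, ?_⟩
      have hm : (Ideal.Quotient.mk v.asIdeal a).out - a ∈ v.asIdeal := by
        rw [← Ideal.Quotient.eq, Ideal.Quotient.mk_out]
      set a' := (Ideal.Quotient.mk v.asIdeal a).out
      have h1 : Valued.v (((algebraMap (𝓞 K) (v.adicCompletionIntegers K) (a' - a) :
          v.adicCompletionIntegers K) : v.adicCompletion K)) < (1 : ℤᵐ⁰) := by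
        rw [HeightOneSpectrum.algebraMap_adicCompletionIntegers_apply,
          HeightOneSpectrum.valuedAdicCompletion_eq_valuation']
        exact (v.valuation_lt_one_iff_mem _).2 hm
      change IsLocalRing.residue _ (g a') = _
      rw [← sub_eq_zero, ← map_sub, IsLocalRing.residue_eq_zero_iff,
        IsLocalRing.mem_maximalIdeal, mem_nonunits_iff,
        Valuation.Integer.not_isUnit_iff_valuation_lt_one]
      have e : (algebraMap (𝓞 K) (v.adicCompletionIntegers K) a' - x' :
          v.adicCompletionIntegers K) = algebraMap (𝓞 K) (v.adicCompletionIntegers K) (a' - a) +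
            (algebraMap (𝓞 K) (v.adicCompletionIntegers K) a - x') := by
        rw [map_sub]; ring
      change Valued.v (((algebraMap (𝓞 K) (v.adicCompletionIntegers K) a' - x' :
          v.adicCompletionIntegers K) : v.adicCompletion K)) < (1 : ℤᵐ⁰)
      rw [e]
      exact (Valued.v.map_add _ _).trans_lt (max_lt h1 ha)
  exact this

/-- The normalized Haar measure on `𝔬_𝔭 ^ m`, with respect to the Borel `σ`-algebra. -/
def haar (K : Type*) [Field K] [NumberField K] (m : ℕ) (v : HeightOneSpectrum (𝓞 K)) :
    @MeasureTheory.Measure (Fin m → v.adicCompletionIntegers K) (borel _) :=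
  letI : MeasurableSpace (Fin m → v.adicCompletionIntegers K) := borel _
  haveI : BorelSpace (Fin m → v.adicCompletionIntegers K) := ⟨rfl⟩
  MeasureTheory.Measure.addHaarMeasure ⊤

/-- The rational prime `p` lying below `𝔭`, i.e. the positive generator of `𝔭 ∩ ℤ`. -/
def below {K : Type*} [Field K] [NumberField K] (v : HeightOneSpectrum (𝓞 K)) : ℕ :=
  Ideal.absNorm (v.asIdeal.under ℤ)

/-! ### Boxes and densities with respect to an integral basis -/

/-- Integral bases of `𝔬`. -/
abbrev IntegralBasis (K : Type*) [Field K] [NumberField K] : Type _ :=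
  Module.Basis (Fin (Module.finrank ℚ K)) ℤ (𝓞 K)

section Density

variable {K : Type*} [Field K] [NumberField K]

/-- `O(H, 𝔼) = { ∑ a_j e_j : a_j ∈ [-H, H) ∩ ℤ }`. -/
def intBox (E : IntegralBasis K) (H : ℕ) : Finset (𝓞 K) :=
  (Fintype.piFinset fun _ : Fin (Module.finrank ℚ K) => Finset.Ico (-(H : ℤ)) (H : ℤ)).image
    fun c => ∑ j, c j • E j

/-- `O(H, 𝔼)^m`. -/
def box (E : IntegralBasis K) (m H : ℕ) : Finset (Fin m → 𝓞 K) :=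
  Fintype.piFinset fun _ => intBox E H

/-- `(2H)^{km}` with `k = [K : ℚ]`, the number of points of `O(H, 𝔼)^m`. -/
def boxSize (K : Type*) [Field K] [NumberField K] (m H : ℕ) : ℝ :=
  (2 * (H : ℝ)) ^ (Module.finrank ℚ K * m)

/-- The proportion of `O(H, 𝔼)^m` lying in `T`. -/
def boxRatio (E : IntegralBasis K) {m : ℕ} (T : Set (Fin m → 𝓞 K)) (H : ℕ) : ℝ :=
  ((box E m H).filter (· ∈ T)).card / boxSize K m H

/-- The upper density of `T` with respect to `𝔼`. -/
def upperDensity (E : IntegralBasis K) {m : ℕ} (T : Set (Fin m → 𝓞 K)) : ℝ :=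
  limsup (boxRatio E T) atTop

/-- The density of `T` with respect to `𝔼` exists and equals `δ`. -/
def HasDensity (E : IntegralBasis K) {m : ℕ} (T : Set (Fin m → 𝓞 K)) (δ : ℝ) : Prop :=
  Tendsto (boxRatio E T) atTop (𝓝 δ)

end Density

/-! ### Systems of local sets, their hypotheses and moments -/

/-- A family `(U_η)`, `η` a nonzero prime of `𝔬` or `η = ∞`, with `U_𝔭 ⊆ 𝔬_𝔭 ^ m` and
`U_∞ ⊆ k_∞ ^ m`, where `k_∞ = 𝔬 ⊗ ℝ` is realised as `ℝ ^ r₁ × ℂ ^ r₂`. -/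
structure LocalSystem (K : Type*) [Field K] [NumberField K] (m : ℕ) where
  /-- the set `U_𝔭` -/
  finite : ∀ v : HeightOneSpectrum (𝓞 K), Set (Fin m → v.adicCompletionIntegers K)
  /-- the set `U_∞` -/
  infinite : Set (Fin m → mixedEmbedding.mixedSpace K)

namespace LocalSystem

variable {K : Type*} [Field K] [NumberField K] {m : ℕ} (U : LocalSystem K m)

/-- `a ∈ U_𝔭`, for a vector `a` over `𝔬`. -/
def MemFinite (v : HeightOneSpectrum (𝓞 K)) (a : Fin m → 𝓞 K) : Prop :=
  (fun i => algebraMap (𝓞 K) (v.adicCompletionIntegers K) (a i)) ∈ U.finite v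

/-- `a ∈ U_∞`, for a vector `a` over `𝔬`. -/
def MemInfinite (a : Fin m → 𝓞 K) : Prop :=
  (fun i => mixedEmbedding K (a i : K)) ∈ U.infinite

/-- The map `P`: the set of all `η` with `a ∈ U_η`; `none` stands for `∞`. -/
def places (a : Fin m → 𝓞 K) : Set (Option (HeightOneSpectrum (𝓞 K))) :=
  {η | η.elim (U.MemInfinite a) (fun v => U.MemFinite v a)}

/-- The set `I` of vectors that lie in infinitely many `U_η`. -/
def exceptional : Set (Fin m → 𝓞 K) := {a | (U.places a).Infinite}

/-- `O(H, 𝔼)_I^m`: the box without the exceptional set. -/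
def boxI (E : IntegralBasis K) (H : ℕ) : Finset (Fin m → 𝓞 K) :=
  (box E m H).filter (· ∉ U.exceptional)

/-- The tail condition: the upper density of the vectors lying in `U_𝔭` for some `𝔭` above a
rational prime `p > M` tends to `0` as `M → ∞`. -/
def TailCondition (E : IntegralBasis K) : Prop :=
  Tendsto (fun M : ℕ => upperDensity E {a | ∃ v, M < below v ∧ U.MemFinite v a}) atTop (𝓝 0)

/-- The system corresponds to `T ⊆ 𝔬 ^ m`: the tail condition holds and the complement of `T`
consists of the vectors that lie in no `U_η`. -/
def CorrespondsTo (E : IntegralBasis K) (T : Set (Fin m → 𝓞 K)) : Prop :=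
  U.TailCondition E ∧ Tᶜ = {a | U.places a = ∅}

/-- The hypotheses of the local-to-global principle for the `n`-th moment. In the last one `S` runs
over the sets `{𝔭_1, …, 𝔭_r}` of `1 ≤ r ≤ n` pairwise distinct primes. The exponent `α` is asked to
be finite, which is more than allowing `α ∈ [0, ∞]`; the weights `w` do not depend on `H`. -/
structure MomentConditions (E : IntegralBasis K) (n : ℕ) : Prop where
  frontier_finite : ∀ v, haar K m v (frontier (U.finite v)) = 0
  frontier_infinite : MeasureTheory.volume (frontier U.infinite) = 0
  cone : Set.Ici (0 : ℝ) • U.infinite = U.infinite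
  tail : U.TailCondition E
  bounds : ∃ (α : ℝ) (c' c : ℤ), 0 ≤ α ∧
    (∀ H : ℕ, 1 ≤ H → ∀ a ∈ U.boxI E H,
      {v | (c' : ℝ) * (H : ℝ) ^ α < below v ∧ U.MemFinite v a}.Finite ∧
      ({v | (c' : ℝ) * (H : ℝ) ^ α < below v ∧ U.MemFinite v a}.ncard : ℤ) < c) ∧
    ∃ w : HeightOneSpectrum (𝓞 K) → ℝ, Summable w ∧
      ∀ H : ℕ, 1 ≤ H → ∀ S : Finset (HeightOneSpectrum (𝓞 K)), S.Nonempty → S.card ≤ n →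
        (∀ v ∈ S, (below v : ℝ) ≤ (c' : ℝ) * (H : ℝ) ^ α) →
        (((U.boxI E H).filter fun a => ∀ v ∈ S, U.MemFinite v a).card : ℝ) ≤
          boxSize K m H * ∏ v ∈ S, w v

/-- The `n`-th moment of the system exists and equals `l`. -/
def HasMoment (E : IntegralBasis K) (n : ℕ) (l : ℝ) : Prop :=
  Tendsto (fun H : ℕ => (∑ a ∈ U.boxI E H, ((U.places a).ncard : ℝ) ^ n) / boxSize K m H)
    atTop (𝓝 l)

/-- The `n`-th moment of the system restricted to `T` exists and equals `l`. -/
def HasRestrictedMoment (E : IntegralBasis K) (T : Set (Fin m → 𝓞 K)) (n : ℕ) (l : ℝ) : Prop :=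
  Tendsto (fun H : ℕ => (∑ a ∈ (U.boxI E H).filter (· ∈ T), ((U.places a).ncard : ℝ) ^ n) /
    ((U.boxI E H).filter (· ∈ T)).card) atTop (𝓝 l)

/-- The variance of the system restricted to `T` (the mean square deviation from the restricted
mean) exists and equals `l`. -/
def HasRestrictedVariance (E : IntegralBasis K) (T : Set (Fin m → 𝓞 K)) (l : ℝ) : Prop :=
  ∃ μT : ℝ, U.HasRestrictedMoment E T 1 μT ∧
    Tendsto (fun H : ℕ => (∑ a ∈ (U.boxI E H).filter (· ∈ T),
      (((U.places a).ncard : ℝ) - μT) ^ 2) / ((box E m H).filter (· ∈ T)).card) atTop (𝓝 l)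

end LocalSystem

/-! ### Shifted Eisenstein polynomials -/

section Eisenstein

/-- The polynomial `a_0 + a_1 x + ⋯ + a_d x ^ d`. -/
def toPoly {R : Type*} [CommRing R] {d : ℕ} (a : Fin (d + 1) → R) : R[X] :=
  ∑ i, C (a i) * X ^ (i : ℕ)

/-- The map `σ_b : f(x) ↦ f(x + b)` on coefficient vectors. -/
def shift {R : Type*} [CommRing R] {d : ℕ} (b : R) (a : Fin (d + 1) → R) : Fin (d + 1) → R :=
  fun i => ((toPoly a).comp (X + C b)).coeff i

/-- The set `(P ∖ P²) × P ^ (d - 1) × (R ∖ P)` (for `d ≥ 1`). -/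
def eisensteinSet {R : Type*} [CommRing R] (P : Ideal R) (d : ℕ) : Set (Fin (d + 1) → R) :=
  {a | a 0 ∉ P ^ 2 ∧ (∀ i, i ≠ Fin.last d → a i ∈ P) ∧ a (Fin.last d) ∉ P}

variable (K : Type*) [Field K] [NumberField K] (d : ℕ)

/-- The set of shifted Eisenstein polynomials of degree `d` over `𝔬`. -/
def shiftedEisenstein : Set (Fin (d + 1) → 𝓞 K) :=
  {a | ∃ (v : HeightOneSpectrum (𝓞 K)) (b : 𝓞 K), shift b a ∈ eisensteinSet v.asIdeal d}

/-- The set `σ_b⁻¹(U_𝔭) ⊆ 𝔬_𝔭 ^ (d + 1)`, where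
`U_𝔭 = (𝔭𝔬_𝔭 ∖ 𝔭²𝔬_𝔭) × (𝔭𝔬_𝔭) ^ (d - 1) × (𝔬_𝔭 ∖ 𝔭𝔬_𝔭)`. -/
def localPiece (v : HeightOneSpectrum (𝓞 K)) (b : 𝓞 K) :
    Set (Fin (d + 1) → v.adicCompletionIntegers K) :=
  shift (algebraMap (𝓞 K) (v.adicCompletionIntegers K) b) ⁻¹'
    eisensteinSet (v.asIdeal.map (algebraMap (𝓞 K) (v.adicCompletionIntegers K))) d

/-- The system with `U_𝔭` the union of `localPiece K d 𝔭 b` over representatives `b` of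
`𝔬 ⧸ 𝔭`, and `U_∞ = ∅`. -/
def shiftedEisensteinSystem : LocalSystem K (d + 1) where
  finite v := ⋃ β : 𝓞 K ⧸ v.asIdeal, localPiece K d v β.out
  infinite := ∅

end Eisenstein

end LocalToGlobal

end

/-!
For each `𝔭`, membership of `a` in the local set depends only on `a` modulo `𝔭²`, so the Chinese
remainder theorem and a lattice point count give the joint densities at finitely many primes. The
limits over growing sets of primes are then controlled by the following algebraic fact. If a shift
of `f` is Eisenstein at `𝔭`, then modulo `𝔭` the polynomial `f` is a constant times the `d`-th power
of a linear polynomial, so all coefficients of the power defect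
`d ^ d a_d ^ (d - 1) f - (d a_d x + a_{d - 1}) ^ d` lie in `𝔭`. For `f` in the box of size `H` these
are algebraic integers bounded polynomially in `H`, and not all zero, so only boundedly many primes
above `p > H ^ β` can divide them. As `d ≥ 3`, two of these coefficients, those of `x ^ (d - 2)` and
`x ^ (d - 3)`, are affine in different coordinates of `f`, with leading coefficient prime to `𝔭`
once `p > d`, and they rarely share a large prime.
-/

noncomputable section

namespace LocalToGlobal

section Shift

variable {R : Type*} [CommRing R] {d : ℕ}

theorem coeff_toPoly (a : Fin (d + 1) → R) (i : Fin (d + 1)) : (toPoly a).coeff i = a i := by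
  simp [toPoly, coeff_X_pow, ← Fin.ext_iff]

theorem coeff_toPoly_zero (a : Fin (d + 1) → R) : (toPoly a).coeff 0 = a 0 :=
  coeff_toPoly a 0

theorem coeff_toPoly_last (a : Fin (d + 1) → R) : (toPoly a).coeff d = a (Fin.last d) :=
  coeff_toPoly a (Fin.last d)

theorem natDegree_toPoly_le (a : Fin (d + 1) → R) : (toPoly a).natDegree ≤ d :=
  natDegree_sum_le_of_forall_le _ _ fun i _ =>
    (natDegree_C_mul_X_pow_le _ _).trans (Nat.lt_succ_iff.1 i.2)

theorem map_toPoly {S : Type*} [CommRing S] (φ : R →+* S) (a : Fin (d + 1) → R) :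
    (toPoly a).map φ = toPoly fun i => φ (a i) := by
  simp [toPoly, Polynomial.map_sum]

theorem toPoly_coeff {p : R[X]} (hp : p.natDegree ≤ d) :
    toPoly (fun i : Fin (d + 1) => p.coeff i) = p := by
  ext n
  rcases lt_or_ge n (d + 1) with h | h
  · exact coeff_toPoly _ ⟨n, h⟩
  · rw [coeff_eq_zero_of_natDegree_lt ((natDegree_toPoly_le _).trans_lt h),
      coeff_eq_zero_of_natDegree_lt (hp.trans_lt h)]

theorem toPoly_shift (b : R) (a : Fin (d + 1) → R) :
    toPoly (shift b a) = taylor b (toPoly a) :=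
  toPoly_coeff ((natDegree_taylor _ _).trans_le (natDegree_toPoly_le a))

theorem shift_shift (b c : R) (a : Fin (d + 1) → R) : shift b (shift c a) = shift (b + c) a := by
  funext i
  rw [← coeff_toPoly (shift b _), ← coeff_toPoly (shift (b + c) a), toPoly_shift, toPoly_shift,
    toPoly_shift, taylor_taylor]

theorem shift_zero (a : Fin (d + 1) → R) : shift 0 a = a := by
  funext i
  rw [← coeff_toPoly (shift 0 a), toPoly_shift, taylor_zero, coeff_toPoly]

theorem shift_bijective (b : R) : Function.Bijective (shift (d := d) b) :=
  Function.bijective_iff_has_inverse.2 ⟨shift (-b), fun a => by simp [shift_shift, shift_zero],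
    fun a => by simp [shift_shift, shift_zero]⟩

theorem shift_map {S : Type*} [CommRing S] (φ : R →+* S) (b : R) (a : Fin (d + 1) → R) :
    shift (φ b) (fun i => φ (a i)) = fun i => φ (shift b a i) := by
  funext i
  rw [← coeff_toPoly (shift b a), ← coeff_map, toPoly_shift, map_taylor, map_toPoly,
    ← toPoly_shift, coeff_toPoly]

theorem shift_apply (b : R) (a : Fin (d + 1) → R) (j : Fin (d + 1)) :
    shift b a j = ∑ i : Fin (d + 1), a i * ((X + C b) ^ (i : ℕ)).coeff j := by
  rw [shift, toPoly, ← coe_compRingHom_apply, map_sum]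
  simp

theorem shift_apply_zero (b : R) (a : Fin (d + 1) → R) : shift b a 0 = (toPoly a).eval b := by
  rw [← coeff_toPoly_zero (shift b a), toPoly_shift, taylor_coeff_zero]

theorem shift_last (b : R) (a : Fin (d + 1) → R) : shift b a (Fin.last d) = a (Fin.last d) := by
  rw [shift_apply, Finset.sum_eq_single (Fin.last d)]
  · simp [coeff_X_add_C_pow]
  · intro i _ hi
    simp [coeff_X_add_C_pow, Nat.choose_eq_zero_of_lt (Fin.val_lt_last hi)]
  · simp

end Shift

section EisensteinModP

variable {R : Type*} [CommRing R] {P : Ideal R} {d : ℕ}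

theorem map_toPoly_eq_C_mul_X_pow {a : Fin (d + 1) → R} (ha : ∀ i, i ≠ Fin.last d → a i ∈ P) :
    (toPoly a).map (Ideal.Quotient.mk P) = C (Ideal.Quotient.mk P (a (Fin.last d))) * X ^ d := by
  rw [map_toPoly, toPoly, Fintype.sum_eq_single (Fin.last d), Fin.val_last]
  intro i hi
  rw [Ideal.Quotient.eq_zero_iff_mem.2 (ha i hi), C_0, zero_mul]

theorem map_toPoly_shift_eq {a : Fin (d + 1) → R} (ha : ∀ i, i ≠ Fin.last d → a i ∈ P) (c : R) :
    (toPoly (shift c a)).map (Ideal.Quotient.mk P) =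
      C (Ideal.Quotient.mk P (a (Fin.last d))) * (X + C (Ideal.Quotient.mk P c)) ^ d := by
  rw [toPoly_shift, map_taylor, map_toPoly_eq_C_mul_X_pow ha, taylor_mul, taylor_C, taylor_X_pow]

theorem shift_apply_zero_sub_mem_sq (hd : 2 ≤ d) {a : Fin (d + 1) → R}
    (ha : ∀ i, i ≠ Fin.last d → a i ∈ P) {c : R} (hc : c ∈ P) : shift c a 0 - a 0 ∈ P ^ 2 := by
  have hsum : shift c a 0 - a 0 = ∑ i : Fin d, a i.succ * c ^ (i + 1 : ℕ) := by
    simp [shift_apply_zero, toPoly, eval_finsetSum, Fin.sum_univ_succ]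
  rw [hsum]
  refine sum_mem fun i _ => ?_
  by_cases hl : i.succ = Fin.last d
  · have hi : 2 ≤ (i + 1 : ℕ) := by
      have := congrArg Fin.val hl
      simp only [Fin.val_succ, Fin.val_last] at this
      omega
    exact Ideal.mul_mem_left _ _ (Ideal.pow_le_pow_right hi (Ideal.pow_mem_pow hc _))
  · rw [pow_two]
    exact Ideal.mul_mem_mul (ha _ hl) (Ideal.pow_mem_of_mem _ hc _ i.val.succ_pos)

theorem shift_mem_eisensteinSet (hd : 2 ≤ d) {a : Fin (d + 1) → R} (ha : a ∈ eisensteinSet P d)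
    {c : R} (hc : c ∈ P) : shift c a ∈ eisensteinSet P d := by
  obtain ⟨h0, h1, h2⟩ := ha
  refine ⟨fun h => h0 ?_, fun j hj => ?_, by rwa [shift_last]⟩
  · simpa using sub_mem h (shift_apply_zero_sub_mem_sq hd h1 hc)
  · have hmod := congrArg (coeff · (j : ℕ)) (map_toPoly_shift_eq h1 c)
    simp only [coeff_map, coeff_toPoly, Ideal.Quotient.eq_zero_iff_mem.2 hc, C_0, add_zero,
      coeff_C_mul, coeff_X_pow, (Fin.val_lt_last hj).ne, if_false, mul_zero] at hmod
    exact Ideal.Quotient.eq_zero_iff_mem.1 hmod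

theorem shift_mem_eisensteinSet_iff (hd : 2 ≤ d) {a : Fin (d + 1) → R} {b b' : R}
    (h : b - b' ∈ P) : shift b a ∈ eisensteinSet P d ↔ shift b' a ∈ eisensteinSet P d := by
  constructor <;> intro H
  · simpa [shift_shift] using shift_mem_eisensteinSet hd H (by simpa using neg_mem h : b' - b ∈ P)
  · simpa [shift_shift] using shift_mem_eisensteinSet hd H h

theorem exists_shift_out_mem_eisensteinSet_iff (hd : 2 ≤ d) (a : Fin (d + 1) → R) :
    (∃ β : R ⧸ P, shift β.out a ∈ eisensteinSet P d) ↔ ∃ b, shift b a ∈ eisensteinSet P d := by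
  refine ⟨fun ⟨β, h⟩ => ⟨_, h⟩, fun ⟨b, h⟩ => ⟨Ideal.Quotient.mk _ b, ?_⟩⟩
  refine (shift_mem_eisensteinSet_iff hd ?_).1 h
  rw [← Ideal.Quotient.eq, Ideal.Quotient.mk_out]

theorem sub_mem_of_shift_mem [P.IsPrime] (hd : 1 ≤ d) {a : Fin (d + 1) → R} {b b' : R}
    (h : shift b a ∈ eisensteinSet P d) (h' : shift b' a ∈ eisensteinSet P d) : b - b' ∈ P := by
  have hmod := congrArg (coeff · 0) (map_toPoly_shift_eq h'.2.1 (b - b'))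
  have h0 : shift b a 0 ∈ P := h.2.1 0 (by simp [Fin.ext_iff]; omega)
  simp only [shift_shift, sub_add_cancel, coeff_map, coeff_toPoly_zero,
    Ideal.Quotient.eq_zero_iff_mem.2 h0, coeff_C_mul, coeff_X_add_C_pow, tsub_zero,
    Nat.choose_zero_right, Nat.cast_one, mul_one, ← map_pow, ← map_mul] at hmod
  have hprime : P.IsPrime := inferInstance
  exact hprime.mem_of_pow_mem _
    ((hprime.mem_or_mem (Ideal.Quotient.eq_zero_iff_mem.1 hmod.symm)).resolve_left h'.2.2)

theorem map_mem_eisensteinSet_iff {S : Type*} [CommRing S] {Q : Ideal S} (φ : R →+* S)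
    (h1 : ∀ x, φ x ∈ Q ↔ x ∈ P) (h2 : ∀ x, φ x ∈ Q ^ 2 ↔ x ∈ P ^ 2) (a : Fin (d + 1) → R) :
    (fun i => φ (a i)) ∈ eisensteinSet Q d ↔ a ∈ eisensteinSet P d := by
  simp [eisensteinSet, h1, h2]

end EisensteinModP

section PowerDefect

variable {R : Type*} [CommRing R] {d : ℕ}

/-- The polynomial `d ^ d a_d ^ (d - 1) f - (d a_d x + a_{d - 1}) ^ d`, where `a_i` are the
coefficients of `f`. It measures how far `f`, regarded as a polynomial of degree `d`, is from being
a constant times the `d`-th power of a linear polynomial. -/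
def powerDefect (d : ℕ) (f : R[X]) : R[X] :=
  C ((d : R) ^ d * f.coeff d ^ (d - 1)) * f - (C (d * f.coeff d) * X + C (f.coeff (d - 1))) ^ d

theorem map_powerDefect {S : Type*} [CommRing S] (φ : R →+* S) (f : R[X]) :
    (powerDefect d f).map φ = powerDefect d (f.map φ) := by
  simp [powerDefect]

theorem coeff_C_mul_X_add_C_pow (u v : R) (d j : ℕ) :
    ((C u * X + C v) ^ d).coeff j = d.choose j * u ^ j * v ^ (d - j) := by
  have hcomp : (C u * X + C v) ^ d = ((X + C v) ^ d).comp (C u * X) := by simp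
  rw [hcomp, comp_C_mul_X_coeff, coeff_X_add_C_pow]
  ring

theorem coeff_powerDefect (f : R[X]) (j : ℕ) :
    (powerDefect d f).coeff j = (d : R) ^ d * f.coeff d ^ (d - 1) * f.coeff j -
      d.choose j * (d * f.coeff d) ^ j * f.coeff (d - 1) ^ (d - j) := by
  rw [powerDefect, coeff_sub, coeff_C_mul, coeff_C_mul_X_add_C_pow]

theorem natDegree_powerDefect_le {f : R[X]} (hf : f.natDegree ≤ d) :
    (powerDefect d f).natDegree ≤ d := by
  refine natDegree_le_iff_coeff_eq_zero.2 fun j hj => ?_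
  rw [coeff_powerDefect, coeff_eq_zero_of_natDegree_lt (hf.trans_lt hj),
    Nat.choose_eq_zero_of_lt hj, Nat.cast_zero]
  ring

theorem powerDefect_C_mul_X_add_C_pow (hd : 1 ≤ d) (c r : R) :
    powerDefect d (C c * (X + C r) ^ d) = 0 := by
  have hlead : (C c * (X + C r) ^ d).coeff d = c := by simp [coeff_X_add_C_pow]
  have hnext : (C c * (X + C r) ^ d).coeff (d - 1) = c * (r * d) := by
    rw [coeff_C_mul, coeff_X_add_C_pow, Nat.sub_sub_self hd, pow_one, Nat.choose_symm hd,
      Nat.choose_one_right]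
  rw [powerDefect, hlead, hnext, sub_eq_zero]
  calc C ((d : R) ^ d * c ^ (d - 1)) * (C c * (X + C r) ^ d)
      = C ((d : R) ^ d * (c ^ (d - 1) * c)) * (X + C r) ^ d := by simp only [C_mul]; ring
    _ = (C ((d : R) * c) * (X + C r)) ^ d := by
        rw [← pow_succ, Nat.sub_add_cancel hd, ← mul_pow, C_pow, ← mul_pow]
    _ = (C ((d : R) * c) * X + C (c * (r * d))) ^ d := by
        congr 1
        simp only [C_mul]
        ring

theorem coeff_powerDefect_mem {P : Ideal R} (hd : 1 ≤ d) {a : Fin (d + 1) → R} {b : R}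
    (h : ∀ i, i ≠ Fin.last d → shift b a i ∈ P) (j : ℕ) :
    (powerDefect d (toPoly a)).coeff j ∈ P := by
  have hmod := map_toPoly_shift_eq h (-b)
  rw [shift_shift, neg_add_cancel, shift_zero] at hmod
  rw [← Ideal.Quotient.eq_zero_iff_mem, ← coeff_map, map_powerDefect, hmod,
    powerDefect_C_mul_X_add_C_pow hd, coeff_zero]

theorem mem_sq_of_pow_mul_eq_pow [IsDomain R] [IsIntegrallyClosed R] {P : Ideal R} [P.IsPrime]
    (hd : 2 ≤ d) {c y z : R} (hc : c ≠ 0) (h : c ^ d * z = y ^ d) (hz : z ∈ P) : z ∈ P ^ 2 := by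
  obtain ⟨w, rfl⟩ : c ∣ y :=
    (IsIntegrallyClosed.pow_dvd_pow_iff (by omega)).1 (Dvd.intro z h)
  obtain rfl : z = w ^ d := mul_left_cancel₀ (pow_ne_zero d hc) (by rw [h, mul_pow])
  have hw : w ∈ P := Ideal.IsPrime.mem_of_pow_mem inferInstance _ hz
  exact Ideal.pow_le_pow_right hd (Ideal.pow_mem_pow hw d)

theorem powerDefect_ne_zero_of_shift_mem [IsDedekindDomain R] {P : Ideal R} [P.IsPrime]
    (hd : 2 ≤ d) (hchar : (d : R) ≠ 0) {a : Fin (d + 1) → R} {b : R}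
    (h : shift b a ∈ eisensteinSet P d) : powerDefect d (toPoly a) ≠ 0 := by
  intro hdef
  obtain ⟨h0, h1, h2⟩ := h
  rw [shift_last] at h2
  have hroot : (d : R) ^ d * (a (Fin.last d) ^ (d - 1) * shift b a 0) =
      (d * a (Fin.last d) * b + (toPoly a).coeff (d - 1)) ^ d := by
    have := congrArg (eval b) hdef
    simp only [powerDefect, eval_sub, eval_mul, eval_C, eval_pow, eval_add, eval_X, eval_zero,
      coeff_toPoly_last, ← shift_apply_zero] at this
    rw [← sub_eq_zero.1 this, mul_assoc]
  have hmem : shift b a 0 ∈ P := h1 0 (by simp [Fin.ext_iff]; omega)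
  have hsq := mem_sq_of_pow_mul_eq_pow hd hchar hroot (Ideal.mul_mem_left _ _ hmem)
  rcases Ideal.IsPrime.mul_mem_pow P hsq with hlast | h0'
  · exact h2 (Ideal.IsPrime.mem_of_pow_mem inferInstance _ hlast)
  · exact h0 h0'

end PowerDefect

section CoordMod

variable {G ι : Type*} [AddCommGroup G] (B : Module.Basis ι ℤ G)

/-- The coordinates with respect to `B`, reduced modulo `q`. -/
def coordMod (q : ℕ) : G →+ (ι → ZMod q) :=
  AddMonoidHom.mk' (fun x i => (B.repr x i : ZMod q)) (by intro x y; funext i; simp)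

variable [Finite ι]

theorem coordMod_equivFun_symm (q : ℕ) (c : ι → ℤ) :
    coordMod B q (B.equivFun.symm c) = fun i => (c i : ZMod q) := by
  funext i
  exact congrArg (Int.cast) (congrFun (B.equivFun.apply_symm_apply c) i)

theorem coordMod_surjective (q : ℕ) : Function.Surjective (coordMod B q) := by
  intro r
  choose c hc using fun i => ZMod.intCast_surjective (r i)
  exact ⟨B.equivFun.symm c, (coordMod_equivFun_symm B q c).trans (funext hc)⟩

theorem exists_eq_nsmul_of_coordMod_eq_zero {q : ℕ} {x : G} (hx : coordMod B q x = 0) :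
    ∃ y, x = q • y := by
  choose t ht using fun i => (ZMod.intCast_zmod_eq_zero_iff_dvd (B.repr x i) q).1 (congrFun hx i)
  refine ⟨B.equivFun.symm t, B.equivFun.injective (funext fun i => ?_)⟩
  rw [map_nsmul, LinearEquiv.apply_symm_apply, Pi.smul_apply, nsmul_eq_mul]
  exact ht i

theorem exists_factor_coordMod {A : Type*} [AddCommGroup A] (π : G →+ A) {q : ℕ}
    (hπ : ∀ x, π (q • x) = 0) : ∃ f : (ι → ZMod q) →+ A, ∀ x, f (coordMod B q x) = π x := by
  have hker : (coordMod B q).ker ≤ π.ker := by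
    intro x hx
    obtain ⟨y, rfl⟩ := exists_eq_nsmul_of_coordMod_eq_zero B hx
    exact hπ y
  exact ⟨(coordMod B q).liftOfSurjective (coordMod_surjective B q) ⟨π, hker⟩,
    AddMonoidHom.liftOfRightInverse_comp_apply _ _ _ _⟩

end CoordMod

section Counting

theorem abs_mul_card_Ico_filter_zmod_sub_le {q : ℕ} (hq : 0 < q) (H : ℕ) (r : ZMod q) :
    |(q * ((Finset.Ico (-(H : ℤ)) H).filter fun t : ℤ => (t : ZMod q) = r).card - 2 * H : ℝ)| ≤
      q := by
  obtain ⟨v, rfl⟩ := ZMod.intCast_surjective r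
  simp only [ZMod.intCast_eq_intCast_iff]
  have hqQ : (0 : ℚ) < q := by exact_mod_cast hq
  have hcard := Int.Ico_filter_modEq_card (-(H : ℤ)) H (r := q) (by exact_mod_cast hq) v
  set N := ((Finset.Ico (-(H : ℤ)) H).filter fun t : ℤ => t ≡ v [ZMOD q]).card
  set x : ℚ := ((H : ℤ) - v : ℚ) / (q : ℤ) with hx
  set y : ℚ := ((-(H : ℤ) : ℤ) - v : ℚ) / (q : ℤ) with hy
  have hxy : q * (x - y) = 2 * H := by
    simp only [hx, hy]
    push_cast
    field_simp
    ring
  have hle : y ≤ x := sub_nonneg.1 ((mul_nonneg_iff_of_pos_left hqQ).1 (hxy ▸ by positivity))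
  rw [max_eq_left (sub_nonneg.2 (Int.ceil_mono hle))] at hcard
  have hN : (N : ℚ) = ⌈x⌉ - ⌈y⌉ := by exact_mod_cast hcard
  have hclose : |(N - (x - y) : ℚ)| ≤ 1 := by
    rw [hN, abs_le]
    constructor <;>
      linarith [Int.le_ceil x, Int.ceil_lt_add_one x, Int.le_ceil y, Int.ceil_lt_add_one y]
  have hscaled : |(q * N - 2 * H : ℚ)| ≤ q := by
    rw [← hxy, ← mul_sub, abs_mul, abs_of_pos hqQ]
    exact mul_le_of_le_one_right hqQ.le hclose
  exact_mod_cast hscaled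

theorem dens_filter_mem_of_surjective {A B : Type*} [AddGroup A] [AddGroup B] [Fintype A]
    [Fintype B] (f : B →+ A) (hf : Function.Surjective f) (s : Finset A) :
    (Finset.univ.filter fun b => f b ∈ s).dens = s.dens := by
  have hfiber (y : A) : (Finset.univ.filter fun b => f b = y).card =
      (Finset.univ.filter fun b => f b = 0).card :=
    AddMonoidHom.card_fiber_eq_of_mem_range f (hf y) (hf 0)
  have hcard (s : Finset A) : (Finset.univ.filter fun b => f b ∈ s).card =
      s.card * (Finset.univ.filter fun b => f b = 0).card := by
    rw [Finset.card_eq_sum_card_fiberwise (f := f) (t := s) (by intro x; simp)]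
    refine Finset.sum_const_nat fun y hy => ?_
    rw [← hfiber y, Finset.filter_filter]
    exact congrArg Finset.card (Finset.filter_congr fun b _ => ⟨And.right, fun h => ⟨h ▸ hy, h⟩⟩)
  have huniv : Fintype.card B = Fintype.card A * (Finset.univ.filter fun b => f b = 0).card := by
    simpa using hcard Finset.univ
  have hpos : 0 < Fintype.card B := Fintype.card_pos
  rw [Finset.dens, Finset.dens, hcard, huniv, Nat.cast_mul, Nat.cast_mul]
  rw [huniv] at hpos
  exact mul_div_mul_right _ _ (Nat.cast_ne_zero.2 (Nat.pos_of_mul_pos_left hpos).ne')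

variable {G ι : Type*} [AddCommGroup G] [Fintype ι] (B : Module.Basis ι ℤ G)

/-- The box of elements all of whose coordinates with respect to `B` lie in `[-H, H)`. -/
def coordBox (H : ℕ) : Finset G :=
  (Fintype.piFinset fun _ : ι => Finset.Ico (-(H : ℤ)) H).map
    B.equivFun.symm.toEquiv.toEmbedding

theorem mem_coordBox {H : ℕ} {x : G} :
    x ∈ coordBox B H ↔ ∀ i, B.repr x i ∈ Finset.Ico (-(H : ℤ)) H := by
  simp only [coordBox, Finset.mem_map_equiv, Fintype.mem_piFinset]
  rfl

theorem card_Ico_neg_self (H : ℕ) : (Finset.Ico (-(H : ℤ)) H).card = 2 * H := by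
  rw [Int.card_Ico]
  omega

theorem card_coordBox (H : ℕ) : (coordBox B H).card = (2 * H) ^ Fintype.card ι := by
  rw [coordBox, Finset.card_map, Fintype.card_piFinset, Finset.prod_const, card_Ico_neg_self,
    Finset.card_univ]

theorem card_coordBox_filter_coordMod_eq (q H : ℕ) (r : ι → ZMod q) :
    ((coordBox B H).filter fun x => coordMod B q x = r).card =
      ∏ i, ((Finset.Ico (-(H : ℤ)) H).filter fun t : ℤ => (t : ZMod q) = r i).card := by
  rw [← Fintype.card_piFinset, coordBox, Finset.filter_map, Finset.card_map]
  congr 1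
  ext c
  have hmod : coordMod B q (B.equivFun.symm c) = r ↔ ∀ i, (c i : ZMod q) = r i := by
    rw [coordMod_equivFun_symm, funext_iff]
  simp only [Finset.mem_filter, Fintype.mem_piFinset, forall_and]
  exact and_congr_right fun _ => hmod

theorem pow_mul_card_coordBox_filter_coordMod (q H : ℕ) (R : Finset (ι → ZMod q)) :
    (q : ℝ) ^ Fintype.card ι * ((coordBox B H).filter fun x => coordMod B q x ∈ R).card =
      ∑ r ∈ R, ∏ i, (q * ((Finset.Ico (-(H : ℤ)) H).filter
        fun t : ℤ => (t : ZMod q) = r i).card : ℝ) := by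
  have hmaps : Set.MapsTo (coordMod B q)
      ((coordBox B H).filter fun x => coordMod B q x ∈ R) R :=
    fun x hx => (Finset.mem_filter.1 hx).2
  rw [Finset.card_eq_sum_card_fiberwise hmaps, Nat.cast_sum, Finset.mul_sum]
  refine Finset.sum_congr rfl fun r hr => ?_
  rw [Finset.filter_filter, Finset.filter_congr fun x _ => show _ ↔ coordMod B q x = r from
    ⟨And.right, fun h => ⟨h ▸ hr, h⟩⟩, card_coordBox_filter_coordMod_eq, Finset.prod_mul_distrib,
    Finset.prod_const, Finset.card_univ, Nat.cast_prod]

variable {A : Type*} [AddCommGroup A] [Fintype A] (π : G →+ A) {q : ℕ}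

theorem exists_residues_card_eq (hsurj : Function.Surjective π) (hq : 0 < q)
    (hπ : ∀ x, π (q • x) = 0) (s : Finset A) :
    ∃ R : Finset (ι → ZMod q), (∀ x, coordMod B q x ∈ R ↔ π x ∈ s) ∧
      (R.card : ℝ) = s.dens * q ^ Fintype.card ι := by
  have : NeZero q := ⟨hq.ne'⟩
  obtain ⟨f, hf⟩ := exists_factor_coordMod B π hπ
  have hfsurj : Function.Surjective f := fun y => (hsurj y).imp' _ fun x hx => (hf x).trans hx
  refine ⟨Finset.univ.filter fun r => f r ∈ s, fun x => by simp [hf], ?_⟩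
  rw [← dens_filter_mem_of_surjective f hfsurj s, Finset.nnratCast_dens, Fintype.card_fun,
    ZMod.card, Nat.cast_pow, div_mul_cancel₀]
  exact pow_ne_zero _ (Nat.cast_ne_zero.2 hq.ne')

theorem card_coordBox_filter_le (hsurj : Function.Surjective π) (hq : 0 < q)
    (hπ : ∀ x, π (q • x) = 0) (s : Finset A) (H : ℕ) :
    (((coordBox B H).filter fun x => π x ∈ s).card : ℝ) ≤
      s.dens * (2 * H + q) ^ Fintype.card ι := by
  obtain ⟨R, hR, hcard⟩ := exists_residues_card_eq B π hsurj hq hπ s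
  have hq' : (0 : ℝ) < q ^ Fintype.card ι := by positivity
  simp only [← hR]
  rw [← mul_le_mul_iff_right₀ hq', pow_mul_card_coordBox_filter_coordMod]
  calc _ ≤ ∑ r ∈ R, ∏ _i : ι, (2 * H + q : ℝ) := by
        gcongr with r _ i
        linarith [(abs_le.1 (abs_mul_card_Ico_filter_zmod_sub_le hq H (r i))).2]
    _ = _ := by
        rw [Finset.sum_const, nsmul_eq_mul, hcard, Finset.prod_const, Finset.card_univ]
        ring

theorem le_card_coordBox_filter (hsurj : Function.Surjective π) (hq : 0 < q)
    (hπ : ∀ x, π (q • x) = 0) (s : Finset A) {H : ℕ} (hH : q ≤ 2 * H) :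
    s.dens * (2 * H - q) ^ Fintype.card ι ≤
      (((coordBox B H).filter fun x => π x ∈ s).card : ℝ) := by
  obtain ⟨R, hR, hcard⟩ := exists_residues_card_eq B π hsurj hq hπ s
  have hq' : (0 : ℝ) < q ^ Fintype.card ι := by positivity
  have hH' : (q : ℝ) ≤ 2 * H := by exact_mod_cast hH
  simp only [← hR]
  rw [← mul_le_mul_iff_right₀ hq', pow_mul_card_coordBox_filter_coordMod]
  calc _ = ∑ r ∈ R, ∏ _i : ι, (2 * H - q : ℝ) := by
        rw [Finset.sum_const, nsmul_eq_mul, hcard, Finset.prod_const, Finset.card_univ]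
        ring
    _ ≤ _ := by
        refine Finset.sum_le_sum fun r _ =>
          Finset.prod_le_prod (fun _ _ => sub_nonneg.2 hH') fun i _ => ?_
        linarith [(abs_le.1 (abs_mul_card_Ico_filter_zmod_sub_le hq H (r i))).1]

end Counting

section Fibers

variable {ι α : Type*} [Fintype ι] [DecidableEq ι] {s : Finset α}

theorem update_mem_piFinset {a : ι → α} (ha : a ∈ Fintype.piFinset fun _ : ι => s) (i₀ : ι) {x : α}
    (hx : x ∈ s) : Function.update a i₀ x ∈ Fintype.piFinset fun _ : ι => s := by
  rw [Fintype.mem_piFinset] at ha ⊢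
  intro i
  rcases eq_or_ne i i₀ with rfl | hi
  · rwa [Function.update_self]
  · rw [Function.update_of_ne hi]
    exact ha i

theorem card_piFinset_filter_mul_card_eq_sum (s : Finset α) (T : Set (ι → α)) (i₀ : ι) :
    ((Fintype.piFinset fun _ : ι => s).filter (· ∈ T)).card * s.card =
      ∑ a ∈ Fintype.piFinset fun _ : ι => s,
        (s.filter fun x => Function.update a i₀ x ∈ T).card := by
  rw [← Finset.card_product, ← Finset.card_sigma]
  refine Finset.card_nbij' (fun p => ⟨Function.update p.1 i₀ p.2, p.1 i₀⟩)
    (fun p => (Function.update p.1 i₀ p.2, p.1 i₀)) ?_ ?_ ?_ ?_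
  · rintro ⟨a, x⟩ hp
    simp only [Finset.coe_product, Set.mem_prod, Finset.mem_coe, Finset.mem_filter] at hp
    simp only [Finset.mem_coe, Finset.mem_sigma, Finset.mem_filter, Function.update_idem,
      Function.update_eq_self]
    exact ⟨update_mem_piFinset hp.1.1 i₀ hp.2, Fintype.mem_piFinset.1 hp.1.1 i₀, hp.1.2⟩
  · rintro ⟨a, x⟩ hp
    simp only [Finset.mem_coe, Finset.mem_sigma, Finset.mem_filter] at hp
    simp only [Finset.coe_product, Set.mem_prod, Finset.mem_coe, Finset.mem_filter]
    exact ⟨⟨update_mem_piFinset hp.1 i₀ hp.2.1, hp.2.2⟩, Fintype.mem_piFinset.1 hp.1 i₀⟩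
  · rintro ⟨a, x⟩ -
    simp
  · rintro ⟨a, x⟩ -
    simp

theorem card_piFinset_filter_mul_card_le (s : Finset α) (T : Set (ι → α)) (i₀ : ι) {B : ℝ}
    (hB : 0 ≤ B)
    (h : ∀ a ∈ Fintype.piFinset fun _ : ι => s, a ∈ T →
      ((s.filter fun x => Function.update a i₀ x ∈ T).card : ℝ) ≤ B) :
    (((Fintype.piFinset fun _ : ι => s).filter (· ∈ T)).card * s.card : ℝ) ≤
      B * s.card ^ Fintype.card ι := by
  have hfiber (a) (ha : a ∈ Fintype.piFinset fun _ : ι => s) :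
      ((s.filter fun x => Function.update a i₀ x ∈ T).card : ℝ) ≤ B := by
    rcases (s.filter fun x => Function.update a i₀ x ∈ T).eq_empty_or_nonempty with h0 | ⟨x, hx⟩
    · rwa [h0, Finset.card_empty, Nat.cast_zero]
    · rw [Finset.mem_filter] at hx
      simpa only [Function.update_idem] using h _ (update_mem_piFinset ha i₀ hx.1) hx.2
  calc _ = ∑ a ∈ Fintype.piFinset fun _ : ι => s,
        ((s.filter fun x => Function.update a i₀ x ∈ T).card : ℝ) :=
        mod_cast card_piFinset_filter_mul_card_eq_sum s T i₀
    _ ≤ ∑ _a ∈ Fintype.piFinset fun _ : ι => s, B := Finset.sum_le_sum hfiber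
    _ = B * s.card ^ Fintype.card ι := by
        rw [Finset.sum_const, nsmul_eq_mul, Fintype.card_piFinset, Finset.prod_const,
          Finset.card_univ, Nat.cast_pow, mul_comm]

end Fibers

section Primes

theorem card_le_of_prod_le {ι : Type*} {S : Finset ι} {f : ι → ℕ} {n H C e : ℕ} (hn : n ≠ 0)
    (hH : 1 ≤ H) (htwo : ∀ i ∈ S, 2 ≤ f i) (hpow : ∀ i ∈ S, H ≤ f i ^ n)
    (hprod : ∏ i ∈ S, f i ≤ C * H ^ e) : S.card ≤ n * e + C := by
  by_contra! hlt
  obtain ⟨S₁, hS₁, hcard₁⟩ := Finset.exists_subset_card_eq (s := S) (n := n * e) (by omega)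
  have hcard₂ : C < (S \ S₁).card := by rw [Finset.card_sdiff_of_subset hS₁]; omega
  have hprod₁ : H ^ e ≤ ∏ i ∈ S₁, f i := by
    rw [← Nat.pow_le_pow_iff_left hn, ← Finset.prod_pow, ← pow_mul, mul_comm, ← hcard₁]
    exact Finset.pow_card_le_prod _ _ _ fun i hi => hpow i (hS₁ hi)
  have hprod₂ : 2 ^ (S \ S₁).card ≤ ∏ i ∈ S \ S₁, f i :=
    Finset.pow_card_le_prod _ _ _ fun i hi => htwo i (Finset.sdiff_subset hi)
  rw [← Finset.prod_sdiff hS₁] at hprod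
  have hle : 2 ^ (S \ S₁).card ≤ C :=
    Nat.le_of_mul_le_mul_right ((Nat.mul_le_mul hprod₂ hprod₁).trans hprod) (pow_pos hH e)
  exact absurd (hcard₂.trans Nat.lt_two_pow_self) (not_lt.2 hle)

variable {K : Type*} [Field K] [NumberField K]

theorem below_prime (v : HeightOneSpectrum (𝓞 K)) : (below v).Prime := by
  have : NeZero v.asIdeal := ⟨v.ne_bot⟩
  have := v.isPrime
  exact Nat.absNorm_under_prime v.asIdeal

theorem intCast_mem_asIdeal_iff (v : HeightOneSpectrum (𝓞 K)) (n : ℤ) :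
    (n : 𝓞 K) ∈ v.asIdeal ↔ (below v : ℤ) ∣ n := by
  have h : (n : 𝓞 K) ∈ v.asIdeal ↔ n ∈ v.asIdeal.under ℤ := by simp [Ideal.mem_comap]
  rw [h, ← Int.ideal_span_absNorm_eq_self (v.asIdeal.under ℤ), Ideal.mem_span_singleton, below]

theorem below_mem (v : HeightOneSpectrum (𝓞 K)) : (below v : 𝓞 K) ∈ v.asIdeal :=
  mod_cast (intCast_mem_asIdeal_iff v (below v)).2 dvd_rfl

theorem natCast_notMem_asIdeal {v : HeightOneSpectrum (𝓞 K)} {n : ℕ} (hn : 0 < n)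
    (h : n < below v) : (n : 𝓞 K) ∉ v.asIdeal := by
  intro hmem
  have hdvd : below v ∣ n := mod_cast (intCast_mem_asIdeal_iff v n).1 (mod_cast hmem)
  exact (Nat.le_of_dvd hn hdvd).not_gt h

theorem absNorm_pos (v : HeightOneSpectrum (𝓞 K)) : 0 < Ideal.absNorm v.asIdeal :=
  Nat.pos_of_ne_zero (Ideal.absNorm_eq_zero_iff.not.2 v.ne_bot)

theorem below_le_absNorm (v : HeightOneSpectrum (𝓞 K)) : below v ≤ Ideal.absNorm v.asIdeal :=
  Nat.le_of_dvd (absNorm_pos v) (Int.absNorm_under_dvd_absNorm v.asIdeal)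

theorem prod_absNorm_le {S : Finset (HeightOneSpectrum (𝓞 K))} {x : 𝓞 K} (hx : x ≠ 0)
    (h : ∀ v ∈ S, x ∈ v.asIdeal) :
    ∏ v ∈ S, Ideal.absNorm v.asIdeal ≤ Ideal.absNorm (Ideal.span {x}) := by
  have hpos : 0 < Ideal.absNorm (Ideal.span {x}) :=
    Nat.pos_of_ne_zero (Ideal.absNorm_eq_zero_iff.not.2 (Ideal.span_singleton_eq_bot.not.2 hx))
  refine Nat.le_of_dvd hpos ?_
  rw [← map_prod]
  refine Ideal.absNorm_dvd_absNorm_of_le (Ideal.dvd_iff_le.1 ?_)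
  refine Finset.prod_dvd_of_coprime (fun v _ w _ hvw => ?_) fun v hv => ?_
  · have := v.isMaximal
    have := w.isMaximal
    exact Ideal.isCoprime_of_isMaximal fun h => hvw (HeightOneSpectrum.ext h)
  · rw [Ideal.dvd_iff_le, Ideal.span_singleton_le_iff_mem]
    exact h v hv

theorem prod_absNorm_le_pow_finrank {S : Finset (HeightOneSpectrum (𝓞 K))} {p : ℕ} (hp : p ≠ 0)
    (h : ∀ v ∈ S, below v = p) :
    ∏ v ∈ S, Ideal.absNorm v.asIdeal ≤ p ^ Module.finrank ℚ K := by
  rw [← RingOfIntegers.rank K, ← Ideal.absNorm_span_natCast]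
  exact prod_absNorm_le (Nat.cast_ne_zero.2 hp) fun v hv => h v hv ▸ below_mem v

theorem finite_below_le (K : Type*) [Field K] [NumberField K] (M : ℝ) :
    {v : HeightOneSpectrum (𝓞 K) | (below v : ℝ) ≤ M}.Finite := by
  refine Set.Finite.of_finite_image (f := HeightOneSpectrum.asIdeal)
    ((Ideal.finite_setOfPred_absNorm_le (S := 𝓞 K) (⌊M⌋₊ ^ Module.finrank ℚ K)).subset ?_)
    fun _ _ _ _ h => HeightOneSpectrum.ext h
  rintro _ ⟨v, hv, rfl⟩
  have hnorm : Ideal.absNorm v.asIdeal ≤ below v ^ Module.finrank ℚ K := by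
    simpa using prod_absNorm_le_pow_finrank (S := {v}) (below_prime v).ne_zero (by simp)
  exact hnorm.trans (Nat.pow_le_pow_left (Nat.le_floor hv) _)

theorem card_le_finrank_of_below_eq {S : Finset (HeightOneSpectrum (𝓞 K))} {p : ℕ}
    (h : ∀ v ∈ S, below v = p) : S.card ≤ Module.finrank ℚ K := by
  rcases S.eq_empty_or_nonempty with rfl | ⟨v, hv⟩
  · exact Nat.zero_le _
  have hp : p.Prime := h v hv ▸ below_prime v
  refine (Nat.pow_le_pow_iff_right hp.one_lt).1 (le_trans ?_
    (prod_absNorm_le_pow_finrank hp.ne_zero h))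
  exact Finset.pow_card_le_prod _ _ _ fun w hw => h w hw ▸ below_le_absNorm w

theorem summable_inv_absNorm_sq (K : Type*) [Field K] [NumberField K] :
    Summable fun v : HeightOneSpectrum (𝓞 K) => ((Ideal.absNorm v.asIdeal : ℝ) ^ 2)⁻¹ := by
  have hs : Summable fun p : ℕ => ((p : ℝ) ^ 2)⁻¹ := Real.summable_nat_pow_inv.2 one_lt_two
  refine summable_of_sum_le (c := Module.finrank ℚ K * ∑' p : ℕ, ((p : ℝ) ^ 2)⁻¹)
    (fun v => by positivity) fun S => ?_
  calc ∑ v ∈ S, ((Ideal.absNorm v.asIdeal : ℝ) ^ 2)⁻¹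
      ≤ ∑ v ∈ S, ((below v : ℝ) ^ 2)⁻¹ := by
        refine Finset.sum_le_sum fun v _ => ?_
        have : (0 : ℝ) < below v := Nat.cast_pos.2 (below_prime v).pos
        gcongr
        exact below_le_absNorm v
    _ = ∑ p ∈ S.image below, ∑ v ∈ S with below v = p, ((below v : ℝ) ^ 2)⁻¹ :=
        (Finset.sum_fiberwise_of_maps_to (fun v hv => Finset.mem_image_of_mem _ hv) _).symm
    _ ≤ ∑ p ∈ S.image below, Module.finrank ℚ K * ((p : ℝ) ^ 2)⁻¹ := by
        refine Finset.sum_le_sum fun p _ => ?_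
        rw [Finset.sum_congr rfl fun v hv => by rw [(Finset.mem_filter.1 hv).2], Finset.sum_const,
          nsmul_eq_mul]
        gcongr
        exact card_le_finrank_of_below_eq fun v hv => (Finset.mem_filter.1 hv).2
    _ ≤ Module.finrank ℚ K * ∑' p : ℕ, ((p : ℝ) ^ 2)⁻¹ := by
        rw [← Finset.mul_sum]
        gcongr
        exact hs.sum_le_tsum _ fun p _ => by positivity

theorem finite_setOf_mem_asIdeal {x : 𝓞 K} (hx : x ≠ 0) :
    {v : HeightOneSpectrum (𝓞 K) | x ∈ v.asIdeal}.Finite := by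
  simpa only [Ideal.dvd_iff_le, Ideal.span_singleton_le_iff_mem] using
    Ideal.finite_factors (Ideal.span_singleton_eq_bot.not.2 hx)

theorem exists_encard_le_of_absNorm_le (K : Type*) [Field K] [NumberField K] {β : ℝ} (hβ : 0 < β)
    (C e : ℕ) : ∃ c : ℕ, ∀ H : ℕ, 1 ≤ H → ∀ x : 𝓞 K, x ≠ 0 →
      Ideal.absNorm (Ideal.span {x}) ≤ C * H ^ e →
        {v : HeightOneSpectrum (𝓞 K) | (H : ℝ) ^ β < below v ∧ x ∈ v.asIdeal}.encard ≤ c := by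
  obtain ⟨n, hn⟩ := exists_nat_gt (1 / β)
  have hn0 : n ≠ 0 := Nat.cast_ne_zero.1 ((one_div_pos.2 hβ).trans hn).ne'
  refine ⟨n * e + C, fun H hH x hx hN => ?_⟩
  have hfin : {v : HeightOneSpectrum (𝓞 K) | (H : ℝ) ^ β < below v ∧ x ∈ v.asIdeal}.Finite :=
    (finite_setOf_mem_asIdeal hx).subset fun v hv => hv.2
  rw [hfin.encard_eq_coe_toFinset_card, Nat.cast_le]
  refine card_le_of_prod_le (f := below) hn0 hH (fun v _ => (below_prime v).two_le)
    (fun v hv => ?_) ?_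
  · have hHv : (H : ℝ) ^ (β * n) ≤ (below v : ℝ) ^ n := by
      rw [Real.rpow_mul (by positivity), Real.rpow_natCast]
      exact pow_le_pow_left₀ (by positivity) (hfin.mem_toFinset.1 hv).1.le _
    have hexp : (1 : ℝ) ≤ β * n := ((div_lt_iff₀' hβ).1 hn).le
    have := Real.self_le_rpow_of_one_le (Nat.one_le_cast.2 hH) hexp
    exact_mod_cast this.trans hHv
  · exact (Finset.prod_le_prod' fun v _ => below_le_absNorm v).trans
      ((prod_absNorm_le hx fun v hv => (hfin.mem_toFinset.1 hv).2).trans hN)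

theorem absNorm_span_singleton_eq_prod_embeddings (x : 𝓞 K) :
    (Ideal.absNorm (Ideal.span {x}) : ℝ) = ∏ σ : K →ₐ[ℚ] ℂ, ‖σ x‖ := by
  rw [← norm_prod, ← Algebra.norm_eq_prod_embeddings ℚ ℂ, ← Algebra.coe_norm_int,
    Ideal.absNorm_span_singleton, eq_ratCast, Rat.cast_intCast, Complex.norm_intCast,
    Nat.cast_natAbs, Int.cast_abs]

end Primes

section Boxes

variable {K : Type*} [Field K] [NumberField K] (E : IntegralBasis K) {m : ℕ}

theorem intBox_eq_coordBox (H : ℕ) : intBox E H = coordBox E H := by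
  ext x
  simp only [intBox, coordBox, Finset.mem_image, Finset.mem_map, Equiv.coe_toEmbedding]
  simp [Module.Basis.equivFun_symm_apply]

theorem box_eq_coordBox (m H : ℕ) : box E m H = coordBox (Pi.basis fun _ : Fin m => E) H := by
  ext x
  simp only [box, Fintype.mem_piFinset, intBox_eq_coordBox, mem_coordBox, Pi.basis_repr]
  exact ⟨fun h i => h i.1 i.2, fun h i j => h ⟨i, j⟩⟩

theorem card_intBox (H : ℕ) : (intBox E H).card = (2 * H) ^ Module.finrank ℚ K := by
  rw [intBox_eq_coordBox, card_coordBox, Fintype.card_fin]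

theorem card_box (m H : ℕ) : ((box E m H).card : ℝ) = boxSize K m H := by
  rw [box, Fintype.card_piFinset, Finset.prod_const, card_intBox, Finset.card_univ,
    Fintype.card_fin, boxSize, pow_mul]
  push_cast
  rfl

theorem boxSize_pos (m : ℕ) {H : ℕ} (hH : 1 ≤ H) : 0 < boxSize K m H := by
  have : (0 : ℝ) < H := by exact_mod_cast hH
  rw [boxSize]
  positivity

theorem boxSize_nonneg (m H : ℕ) : 0 ≤ boxSize K m H := by
  rw [boxSize]
  positivity

theorem boxRatio_nonneg (T : Set (Fin m → 𝓞 K)) (H : ℕ) : 0 ≤ boxRatio E T H :=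
  div_nonneg (Nat.cast_nonneg _) (boxSize_nonneg _ _)

theorem boxRatio_mono {T T' : Set (Fin m → 𝓞 K)} (h : T ⊆ T') (H : ℕ) :
    boxRatio E T H ≤ boxRatio E T' H :=
  div_le_div_of_nonneg_right (Nat.cast_le.2 (Finset.card_le_card
    (Finset.monotone_filter_right _ fun _ _ ha => h ha))) (boxSize_nonneg _ _)

theorem boxRatio_union_le (T T' : Set (Fin m → 𝓞 K)) (H : ℕ) :
    boxRatio E (T ∪ T') H ≤ boxRatio E T H + boxRatio E T' H := by
  rw [boxRatio, boxRatio, boxRatio, ← add_div]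
  refine div_le_div_of_nonneg_right ?_ (boxSize_nonneg _ _)
  simp only [Set.mem_union, Finset.filter_or]
  exact_mod_cast Finset.card_union_le _ _

theorem boxRatio_biUnion_le {ι : Type*} (S : Finset ι) (T : ι → Set (Fin m → 𝓞 K)) (H : ℕ) :
    boxRatio E (⋃ i ∈ S, T i) H ≤ ∑ i ∈ S, boxRatio E (T i) H := by
  simp only [boxRatio, ← Finset.sum_div]
  refine div_le_div_of_nonneg_right ?_ (boxSize_nonneg _ _)
  refine le_trans (Nat.cast_le.2 (Finset.card_le_card ?_)) (mod_cast Finset.card_biUnion_le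
    (s := S) (t := fun i => (box E m H).filter (· ∈ T i)))
  intro a ha
  obtain ⟨hbox, hmem⟩ := Finset.mem_filter.1 ha
  obtain ⟨i, hi, hai⟩ := Set.mem_iUnion₂.1 hmem
  exact Finset.mem_biUnion.2 ⟨i, hi, Finset.mem_filter.2 ⟨hbox, hai⟩⟩

theorem boxRatio_compl (T : Set (Fin m → 𝓞 K)) {H : ℕ} (hH : 1 ≤ H) :
    boxRatio E Tᶜ H = 1 - boxRatio E T H := by
  have h := Finset.card_filter_add_card_filter_not (s := box E m H) (· ∈ T)
  rw [eq_sub_iff_add_eq, boxRatio, boxRatio, ← add_div,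
    div_eq_one_iff_eq (boxSize_pos m hH).ne', ← card_box E, ← h, Nat.cast_add, add_comm]
  simp only [Set.mem_compl_iff]

theorem boxRatio_le_one (T : Set (Fin m → 𝓞 K)) (H : ℕ) : boxRatio E T H ≤ 1 := by
  refine div_le_one_of_le₀ ?_ (boxSize_nonneg _ _)
  rw [← card_box E]
  exact_mod_cast Finset.card_filter_le _ _

theorem HasDensity.compl {T : Set (Fin m → 𝓞 K)} {δ : ℝ} (h : HasDensity E T δ) :
    HasDensity E Tᶜ (1 - δ) := by
  refine (tendsto_const_nhds.sub h).congr' ?_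
  filter_upwards [eventually_ge_atTop 1] with H hH
  rw [boxRatio_compl E T hH]

theorem boxRatio_le_of_update {T : Set (Fin m → 𝓞 K)} (i₀ : Fin m) {B : ℝ} (hB : 0 ≤ B)
    {H : ℕ} (hH : 1 ≤ H)
    (h : ∀ a ∈ box E m H, a ∈ T →
      (((intBox E H).filter fun x => Function.update a i₀ x ∈ T).card : ℝ) ≤
        B * (2 * H) ^ Module.finrank ℚ K) :
    boxRatio E T H ≤ B := by
  have : (0 : ℝ) < 2 * H := by positivity
  have hcard := card_piFinset_filter_mul_card_le (intBox E H) T i₀ (by positivity) h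
  rw [boxRatio, div_le_iff₀ (boxSize_pos m hH), boxSize, pow_mul]
  refine le_of_mul_le_mul_right (hcard.trans_eq ?_)
    (show (0 : ℝ) < (intBox E H).card by rw [card_intBox]; positivity)
  rw [card_intBox, Fintype.card_fin]
  push_cast
  ring

end Boxes

section ResidueClass

variable {K : Type*} [Field K] [NumberField K]

theorem exists_basis_notMem {R ι : Type*} [CommRing R] [Finite ι] (E : Module.Basis ι ℤ R)
    {I : Ideal R} (hI : I ≠ ⊤) : ∃ j, E j ∉ I := by
  have := Fintype.ofFinite ι
  by_contra! h
  refine hI ((Ideal.eq_top_iff_one _).2 ?_)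
  rw [← E.sum_repr 1]
  exact sum_mem fun j _ => zsmul_mem (h j) _

theorem intCast_eq_of_sub_smul_mem {v : HeightOneSpectrum (𝓞 K)} {x y : ℤ} {e : 𝓞 K}
    (he : e ∉ v.asIdeal) (h : (x - y) • e ∈ v.asIdeal) : (x : ZMod (below v)) = y := by
  rw [zsmul_eq_mul] at h
  rw [← sub_eq_zero, ← Int.cast_sub, ZMod.intCast_zmod_eq_zero_iff_dvd]
  exact (intCast_mem_asIdeal_iff v _).1 ((v.isPrime.mem_or_mem h).resolve_right he)

theorem equivFun_symm_update_sub {G ι : Type*} [AddCommGroup G] [Finite ι] [DecidableEq ι]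
    (B : Module.Basis ι ℤ G) (c : ι → ℤ) (j : ι) (t : ℤ) :
    B.equivFun.symm (Function.update c j t) - B.equivFun.symm c = (t - c j) • B j := by
  have := Fintype.ofFinite ι
  have hsingle : Function.update c j t - c = Pi.single j (t - c j) := by
    rw [← Function.update_eq_self j c, ← Function.update_sub]
    simp [Pi.single]
  rw [← map_sub, hsingle, Module.Basis.equivFun_symm_apply, Finset.sum_eq_single j]
  · rw [Pi.single_eq_same]
  · intro i _ hi
    rw [Pi.single_eq_of_ne hi, zero_smul]
  · simp

/- Unlike equidistribution modulo `𝔭`, this is useful when `𝔭` is large compared to `H`: a single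
coordinate is already constant modulo the rational prime below `𝔭`. -/
theorem card_le_of_sub_mem_asIdeal (E : IntegralBasis K) (v : HeightOneSpectrum (𝓞 K)) {H : ℕ}
    (hH : 1 ≤ H) {U : Finset (𝓞 K)} (hU : U ⊆ intBox E H)
    (h : ∀ x ∈ U, ∀ y ∈ U, x - y ∈ v.asIdeal) :
    (U.card : ℝ) ≤ ((below v : ℝ)⁻¹ + (2 * H : ℝ)⁻¹) * (2 * H) ^ Module.finrank ℚ K := by
  have hH' : (0 : ℝ) < 2 * H := by positivity
  have hp : (0 : ℝ) < below v := Nat.cast_pos.2 (below_prime v).pos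
  obtain ⟨j, hj⟩ := exists_basis_notMem E v.isPrime.ne_top
  set I := Finset.Ico (-(H : ℤ)) H with hI
  obtain ⟨T, hT⟩ : ∃ T : Set _, ∀ c, c ∈ T ↔ E.equivFun.symm c ∈ U := ⟨_, fun _ => Iff.rfl⟩
  have hline (c) (hc : c ∈ T) :
      ((I.filter fun t => Function.update c j t ∈ T).card : ℝ) ≤
        (2 * H + below v) / below v := by
    rw [le_div_iff₀ hp, mul_comm]
    have hclass := (abs_le.1 (abs_mul_card_Ico_filter_zmod_sub_le (below_prime v).pos H
      (c j : ZMod (below v)))).2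
    refine le_trans ?_ (sub_le_iff_le_add'.1 hclass)
    gcongr with t _
    intro ht
    refine intCast_eq_of_sub_smul_mem hj ?_
    rw [← equivFun_symm_update_sub]
    exact h _ ((hT _).1 ht) _ ((hT _).1 hc)
  have hfiber := card_piFinset_filter_mul_card_le I T j
    (B := (2 * H + below v) / below v) (by positivity) fun c _ hc => hline c hc
  have hUcard : U.card ≤ ((Fintype.piFinset fun _ => I).filter (· ∈ T)).card := by
    refine Finset.card_le_card_of_injOn E.equivFun (fun x hx => ?_) E.equivFun.injective.injOn
    rw [Finset.mem_coe, Finset.mem_filter, hT, LinearEquiv.symm_apply_apply]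
    have hxbox := hU hx
    rw [intBox_eq_coordBox, mem_coordBox] at hxbox
    exact ⟨Fintype.mem_piFinset.2 hxbox, hx⟩
  refine le_of_mul_le_mul_right ?_ hH'
  rw [hI, card_Ico_neg_self, Fintype.card_fin, ← hI] at hfiber
  push_cast at hfiber
  calc (U.card * (2 * H) : ℝ) ≤ _ := by gcongr
    _ ≤ _ := hfiber
    _ = _ := by field_simp

end ResidueClass

section CongruenceConditions

variable {K : Type*} [Field K] [NumberField K] {m e : ℕ}

theorem dens_piFinset {ι : Type*} [Fintype ι] [DecidableEq ι] {α : ι → Type*} [∀ i, Fintype (α i)]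
    (s : ∀ i, Finset (α i)) : (Fintype.piFinset s).dens = ∏ i, (s i).dens := by
  simp only [Finset.dens, Fintype.card_piFinset, Fintype.card_pi, Nat.cast_prod,
    Finset.prod_div_distrib]

instance fintypeQuotientPow (v : HeightOneSpectrum (𝓞 K)) (e : ℕ) :
    Fintype (𝓞 K ⧸ v.asIdeal ^ e) :=
  haveI : Finite (𝓞 K ⧸ v.asIdeal ^ e) :=
    Ideal.finiteQuotientOfFreeOfNeBot _ (pow_ne_zero e v.ne_bot)
  Fintype.ofFinite _

/-- The reduction modulo `𝔭 ^ e` of a vector over `𝔬`. -/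
def reduce (v : HeightOneSpectrum (𝓞 K)) (e : ℕ) :
    (Fin m → 𝓞 K) →+ (Fin m → 𝓞 K ⧸ v.asIdeal ^ e) :=
  (Ideal.Quotient.mk (v.asIdeal ^ e)).toAddMonoidHom.compLeft (Fin m)

/-- The simultaneous reductions modulo `𝔭 ^ e` for the primes `𝔭 ∈ S`. -/
def reduceAll (S : Finset (HeightOneSpectrum (𝓞 K))) (e : ℕ) :
    (Fin m → 𝓞 K) →+ ∀ v : S, Fin m → 𝓞 K ⧸ v.1.asIdeal ^ e :=
  AddMonoidHom.pi fun v => reduce v.1 e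

theorem reduceAll_surjective (S : Finset (HeightOneSpectrum (𝓞 K))) (e : ℕ) :
    Function.Surjective (reduceAll (m := m) S e) := by
  have hco : Pairwise (Function.onFun IsCoprime fun v : S => v.1.asIdeal ^ e) := by
    intro v w hvw
    have := v.1.isMaximal
    have := w.1.isMaximal
    exact (Ideal.isCoprime_of_isMaximal fun h =>
      hvw (Subtype.ext (HeightOneSpectrum.ext h))).pow
  intro y
  choose a ha using fun i => Ideal.pi_quotient_surjective hco fun v => y v i
  exact ⟨a, funext fun v => funext fun i => ha i v⟩

/-- A positive integer lying in `𝔭 ^ e` for every `𝔭 ∈ S`. -/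
def modulus (S : Finset (HeightOneSpectrum (𝓞 K))) (e : ℕ) : ℕ :=
  ∏ v ∈ S, below v ^ e

theorem modulus_pos (S : Finset (HeightOneSpectrum (𝓞 K))) (e : ℕ) : 0 < modulus S e :=
  Finset.prod_pos fun v _ => pow_pos (below_prime v).pos e

theorem reduceAll_modulus_nsmul (S : Finset (HeightOneSpectrum (𝓞 K))) (e : ℕ)
    (x : Fin m → 𝓞 K) : reduceAll S e (modulus S e • x) = 0 := by
  funext v i
  refine Ideal.Quotient.eq_zero_iff_mem.2 ?_
  have hmem : (modulus S e : 𝓞 K) ∈ v.1.asIdeal ^ e := by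
    rw [modulus, ← Finset.mul_prod_erase _ _ v.2, Nat.cast_mul, Nat.cast_pow]
    exact Ideal.mul_mem_right _ _ (Ideal.pow_mem_pow (below_mem v.1) e)
  rw [Pi.smul_apply, nsmul_eq_mul]
  exact Ideal.mul_mem_right _ _ hmem

variable (E : IntegralBasis K) (S : Finset (HeightOneSpectrum (𝓞 K)))
  (t : ∀ v : HeightOneSpectrum (𝓞 K), Finset (Fin m → 𝓞 K ⧸ v.asIdeal ^ e))

theorem boxRatio_forall_reduce_mem (H : ℕ) :
    boxRatio E {a | ∀ v ∈ S, reduce v e a ∈ t v} H =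
      ((coordBox (Pi.basis fun _ : Fin m => E) H).filter fun a =>
        reduceAll S e a ∈ Fintype.piFinset fun v : S => t v.1).card / boxSize K m H := by
  have hiff (a : Fin m → 𝓞 K) : (a ∈ {a | ∀ v ∈ S, reduce v e a ∈ t v}) ↔
      reduceAll S e a ∈ Fintype.piFinset fun v : S => t v.1 := by
    rw [Fintype.mem_piFinset, Set.mem_ofPred_eq]
    exact ⟨fun h v => h v.1 v.2, fun h v hv => h ⟨v, hv⟩⟩
  simp only [boxRatio, box_eq_coordBox, hiff]

theorem dens_piFinset_subtype :
    ((Fintype.piFinset fun v : S => t v.1).dens : ℝ) = ∏ v ∈ S, ((t v).dens : ℝ) := by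
  rw [dens_piFinset, NNRat.cast_prod, ← Finset.prod_coe_sort S fun v => ((t v).dens : ℝ)]

theorem card_sigma_fin (k m : ℕ) : Fintype.card (Σ _ : Fin m, Fin k) = k * m := by
  rw [Fintype.card_sigma]
  simp [mul_comm]

theorem boxRatio_forall_reduce_mem_le {H : ℕ} (hH : 1 ≤ H) :
    boxRatio E {a | ∀ v ∈ S, reduce v e a ∈ t v} H ≤
      (∏ v ∈ S, ((t v).dens : ℝ)) *
        (1 + modulus S e / (2 * H)) ^ (Module.finrank ℚ K * m) := by
  have hH' : (0 : ℝ) < 2 * H := by positivity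
  have hcard := card_coordBox_filter_le (Pi.basis fun _ : Fin m => E) (reduceAll S e)
    (reduceAll_surjective S e) (modulus_pos S e) (reduceAll_modulus_nsmul S e)
    (Fintype.piFinset fun v : S => t v.1) H
  rw [card_sigma_fin, dens_piFinset_subtype] at hcard
  rw [boxRatio_forall_reduce_mem, div_le_iff₀ (boxSize_pos m hH), boxSize, mul_assoc, ← mul_pow,
    add_mul, one_mul, div_mul_cancel₀ _ hH'.ne']
  refine le_of_eq_of_le ?_ hcard
  congr!

theorem le_boxRatio_forall_reduce_mem {H : ℕ} (hH : modulus S e ≤ 2 * H) :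
    (∏ v ∈ S, ((t v).dens : ℝ)) *
        (1 - modulus S e / (2 * H)) ^ (Module.finrank ℚ K * m) ≤
      boxRatio E {a | ∀ v ∈ S, reduce v e a ∈ t v} H := by
  have hH1 : 1 ≤ H := by have := modulus_pos S e; omega
  have hH' : (0 : ℝ) < 2 * H := by positivity
  have hcard := le_card_coordBox_filter (Pi.basis fun _ : Fin m => E) (reduceAll S e)
    (reduceAll_surjective S e) (modulus_pos S e) (reduceAll_modulus_nsmul S e)
    (Fintype.piFinset fun v : S => t v.1) hH
  rw [card_sigma_fin, dens_piFinset_subtype] at hcard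
  rw [boxRatio_forall_reduce_mem, le_div_iff₀ (boxSize_pos m hH1), boxSize, mul_assoc, ← mul_pow,
    sub_mul, one_mul, div_mul_cancel₀ _ hH'.ne']
  refine hcard.trans_eq ?_
  congr!

theorem boxRatio_forall_reduce_mem_le_two_pow_mul {H : ℕ} (hH : modulus S e ≤ 2 * H) :
    boxRatio E {a | ∀ v ∈ S, reduce v e a ∈ t v} H ≤
      2 ^ (Module.finrank ℚ K * m) * ∏ v ∈ S, ((t v).dens : ℝ) := by
  have hH1 : 1 ≤ H := by have := modulus_pos S e; omega
  refine (boxRatio_forall_reduce_mem_le E S t hH1).trans ?_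
  rw [mul_comm]
  have hle : (modulus S e : ℝ) / (2 * H) ≤ 1 :=
    div_le_one_of_le₀ (by exact_mod_cast hH) (by positivity)
  gcongr
  linarith

theorem hasDensity_forall_reduce_mem :
    HasDensity E {a | ∀ v ∈ S, reduce v e a ∈ t v} (∏ v ∈ S, ((t v).dens : ℝ)) := by
  have h0 : Tendsto (fun H : ℕ => (modulus S e : ℝ) / (2 * H)) atTop (𝓝 0) :=
    tendsto_const_nhds.div_atTop (tendsto_natCast_atTop_atTop.const_mul_atTop two_pos)
  refine tendsto_of_tendsto_of_tendsto_of_le_of_le'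
    (by simpa using ((h0.const_sub 1).pow (Module.finrank ℚ K * m)).const_mul _)
    (by simpa using ((h0.const_add 1).pow (Module.finrank ℚ K * m)).const_mul _) ?_ ?_
  · filter_upwards [eventually_ge_atTop (modulus S e)] with H hH
    exact le_boxRatio_forall_reduce_mem E S t (by omega)
  · filter_upwards [eventually_ge_atTop 1] with H hH
    exact boxRatio_forall_reduce_mem_le E S t hH

end CongruenceConditions

section PrimesUpTo

variable (K : Type*) [Field K] [NumberField K]

/-- The finite set of primes of `𝔬` above a rational prime that is at most `x`. -/
def primesUpTo (x : ℝ) : Finset (HeightOneSpectrum (𝓞 K)) :=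
  (finite_below_le K x).toFinset

variable {K}

theorem mem_primesUpTo {x : ℝ} {v : HeightOneSpectrum (𝓞 K)} :
    v ∈ primesUpTo K x ↔ (below v : ℝ) ≤ x := by
  rw [primesUpTo, Set.Finite.mem_toFinset, Set.mem_ofPred_eq]

theorem tendsto_primesUpTo : Tendsto (primesUpTo K) atTop atTop :=
  tendsto_atTop_finset_of_monotone
    (fun _ _ h _ hv => mem_primesUpTo.2 ((mem_primesUpTo.1 hv).trans h))
    fun v => ⟨below v, mem_primesUpTo.2 le_rfl⟩

theorem modulus_le_of_below_le_rpow {S : Finset (HeightOneSpectrum (𝓞 K))} {e n H : ℕ}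
    (he : e ≠ 0) (hn : n ≠ 0) (hH : 1 ≤ H) (hcard : S.card ≤ n)
    (hS : ∀ v ∈ S, (below v : ℝ) ≤ (H : ℝ) ^ (1 / (e * n : ℝ))) : modulus S e ≤ H := by
  have hpow (v) (hv : v ∈ S) : (below v : ℝ) ^ e ≤ (H : ℝ) ^ (n : ℝ)⁻¹ := by
    calc (below v : ℝ) ^ e ≤ ((H : ℝ) ^ (1 / (e * n : ℝ))) ^ e := by gcongr; exact hS v hv
      _ = (H : ℝ) ^ (n : ℝ)⁻¹ := by
        rw [← Real.rpow_mul_natCast (Nat.cast_nonneg H)]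
        congr 1
        field_simp
  have hprod : ∏ v ∈ S, (below v : ℝ) ^ e ≤ H := by
    calc ∏ v ∈ S, (below v : ℝ) ^ e ≤ ∏ _v ∈ S, (H : ℝ) ^ (n : ℝ)⁻¹ :=
          Finset.prod_le_prod (fun _ _ => by positivity) hpow
      _ = ((H : ℝ) ^ (n : ℝ)⁻¹) ^ S.card := Finset.prod_const _
      _ ≤ ((H : ℝ) ^ (n : ℝ)⁻¹) ^ n :=
        pow_le_pow_right₀ (Real.one_le_rpow (mod_cast hH) (by positivity)) hcard
      _ = H := Real.rpow_inv_natCast_pow (Nat.cast_nonneg H) hn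
  exact_mod_cast hprod

theorem exists_mem_box (E : IntegralBasis K) {m : ℕ} (a : Fin m → 𝓞 K) :
    ∃ H : ℕ, 1 ≤ H ∧ a ∈ box E m H := by
  refine ⟨1 + ∑ i, ∑ j, (E.repr (a i) j).natAbs, by omega, Fintype.mem_piFinset.2 fun i => ?_⟩
  rw [intBox_eq_coordBox, mem_coordBox]
  intro j
  have hj := Finset.single_le_sum (f := fun j => (E.repr (a i) j).natAbs)
    (fun _ _ => Nat.zero_le _) (Finset.mem_univ j)
  have hi := Finset.single_le_sum (f := fun i => ∑ j, (E.repr (a i) j).natAbs)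
    (fun _ _ => Nat.zero_le _) (Finset.mem_univ i)
  rw [Finset.mem_Ico]
  omega

end PrimesUpTo

namespace LocalSystem

variable {K : Type*} [Field K] [NumberField K] {m : ℕ}

/-- A system without condition at `∞` for which `a ∈ U_𝔭` is a congruence condition modulo
`𝔭 ^ e`, satisfied by the proportion `s 𝔭` of all residue vectors, with `∑ s 𝔭 < ∞`, and for which
primes above rational primes larger than a power of `H` contribute boundedly often to the vectors
in the box of size `H`, and only for a set of vectors of density `0`. -/
structure IsCongruenceSieve (U : LocalSystem K m) (E : IntegralBasis K) (e : ℕ)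
    (s : HeightOneSpectrum (𝓞 K) → ℝ) : Prop where
  infinite_eq_empty : U.infinite = ∅
  exponent_ne_zero : e ≠ 0
  exists_residues : ∀ v, ∃ t : Finset (Fin m → 𝓞 K ⧸ v.asIdeal ^ e), (t.dens : ℝ) = s v ∧
    ∀ a, U.MemFinite v a ↔ reduce v e a ∈ t
  summable : Summable s
  encard_large_le : ∀ β : ℝ, 0 < β → ∃ c : ℕ, ∀ H : ℕ, 1 ≤ H → ∀ a ∈ box E m H,
    {v | (H : ℝ) ^ β < below v ∧ U.MemFinite v a}.encard ≤ c
  tendsto_large : ∀ β : ℝ, 0 < β → Tendsto (fun H : ℕ =>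
    boxRatio E {a | ∃ v, (H : ℝ) ^ β < below v ∧ U.MemFinite v a} H) atTop (𝓝 0)

namespace IsCongruenceSieve

variable {U : LocalSystem K m} {E : IntegralBasis K} {e : ℕ} {s : HeightOneSpectrum (𝓞 K) → ℝ}

theorem nonneg (hU : U.IsCongruenceSieve E e s) (v : HeightOneSpectrum (𝓞 K)) : 0 ≤ s v := by
  obtain ⟨t, ht, -⟩ := hU.exists_residues v
  rw [← ht]
  exact NNRat.cast_nonneg _

theorem hasDensity_forall_memFinite (hU : U.IsCongruenceSieve E e s)
    (S : Finset (HeightOneSpectrum (𝓞 K))) :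
    HasDensity E {a | ∀ v ∈ S, U.MemFinite v a} (∏ v ∈ S, s v) := by
  choose t ht hmem using hU.exists_residues
  simpa only [hmem, ht] using hasDensity_forall_reduce_mem E S t

theorem hasDensity_forall_not_memFinite (hU : U.IsCongruenceSieve E e s)
    (S : Finset (HeightOneSpectrum (𝓞 K))) :
    HasDensity E {a | ∀ v ∈ S, ¬ U.MemFinite v a} (∏ v ∈ S, (1 - s v)) := by
  choose t ht hmem using hU.exists_residues
  have hdens (v) : (((t v)ᶜ.dens : ℚ≥0) : ℝ) = 1 - s v := by
    rw [← ht v, eq_sub_iff_add_eq', ← NNRat.cast_add,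
      ← Finset.dens_union_of_disjoint disjoint_compl_right, Finset.union_compl, Finset.dens_univ,
      NNRat.cast_one]
  simpa only [hmem, hdens, Finset.mem_compl] using
    hasDensity_forall_reduce_mem E S fun v => (t v)ᶜ

theorem boxRatio_forall_memFinite_le (hU : U.IsCongruenceSieve E e s) {n H : ℕ} (hn : n ≠ 0)
    (hH : 1 ≤ H) {S : Finset (HeightOneSpectrum (𝓞 K))} (hcard : S.card ≤ n)
    (hS : ∀ v ∈ S, (below v : ℝ) ≤ (H : ℝ) ^ (1 / (e * n : ℝ))) :
    boxRatio E {a | ∀ v ∈ S, U.MemFinite v a} H ≤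
      2 ^ (Module.finrank ℚ K * m) * ∏ v ∈ S, s v := by
  choose t ht hmem using hU.exists_residues
  have hmod := modulus_le_of_below_le_rpow hU.exponent_ne_zero hn hH hcard hS
  simpa only [hmem, ht] using boxRatio_forall_reduce_mem_le_two_pow_mul E S t (by omega)

theorem places_eq (hU : U.IsCongruenceSieve E e s) (a : Fin m → 𝓞 K) :
    U.places a = some '' {v | U.MemFinite v a} := by
  ext η
  rcases η with _ | v <;> simp [places, MemInfinite, hU.infinite_eq_empty]

theorem finite_setOf_memFinite (hU : U.IsCongruenceSieve E e s) (a : Fin m → 𝓞 K) :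
    {v | U.MemFinite v a}.Finite := by
  obtain ⟨H, hH, ha⟩ := exists_mem_box E a
  obtain ⟨c, hc⟩ := hU.encard_large_le 1 one_pos
  refine ((finite_below_le K ((H : ℝ) ^ (1 : ℝ))).union
    (Set.finite_of_encard_le_coe (hc H hH a ha))).subset fun v hv => ?_
  exact (le_or_gt (below v : ℝ) ((H : ℝ) ^ (1 : ℝ))).imp id fun h => ⟨h, hv⟩

theorem exceptional_eq_empty (hU : U.IsCongruenceSieve E e s) : U.exceptional = ∅ := by
  refine Set.eq_empty_iff_forall_notMem.2 fun a ha => ha ?_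
  rw [hU.places_eq]
  exact (hU.finite_setOf_memFinite a).image _

theorem boxI_eq (hU : U.IsCongruenceSieve E e s) (H : ℕ) : U.boxI E H = box E m H := by
  simp [boxI, hU.exceptional_eq_empty]

theorem boxRatio_exists_lt_below_le (hU : U.IsCongruenceSieve E e s) (M : ℕ) {H : ℕ}
    (hH : 1 ≤ H) :
    boxRatio E {a | ∃ v, M < below v ∧ U.MemFinite v a} H ≤
      2 ^ (Module.finrank ℚ K * m) * (∑' v, s v - ∑ v ∈ primesUpTo K M, s v) +
        boxRatio E {a | ∃ v, (H : ℝ) ^ (1 / e : ℝ) < below v ∧ U.MemFinite v a} H := by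
  set V := primesUpTo K ((H : ℝ) ^ (1 / e : ℝ)) \ primesUpTo K M with hV
  have hmem (v) : v ∈ V ↔ (below v : ℝ) ≤ (H : ℝ) ^ (1 / e : ℝ) ∧ M < below v := by
    simp [hV, mem_primesUpTo]
  let T (v : HeightOneSpectrum (𝓞 K)) : Set (Fin m → 𝓞 K) :=
    {a | ∀ w ∈ ({v} : Finset _), U.MemFinite w a}
  have hsub : {a | ∃ v, M < below v ∧ U.MemFinite v a} ⊆ (⋃ v ∈ V, T v) ∪
      {a | ∃ v, (H : ℝ) ^ (1 / e : ℝ) < below v ∧ U.MemFinite v a} := by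
    rintro a ⟨v, hv, hva⟩
    rcases le_or_gt (below v : ℝ) ((H : ℝ) ^ (1 / e : ℝ)) with h | h
    · exact Or.inl (Set.mem_iUnion₂.2 ⟨v, (hmem v).2 ⟨h, hv⟩, by simpa [T] using hva⟩)
    · exact Or.inr ⟨v, h, hva⟩
  refine (boxRatio_mono E hsub H).trans ((boxRatio_union_le E _ _ H).trans
    (add_le_add_left ((boxRatio_biUnion_le E V T H).trans ?_) _))
  calc ∑ v ∈ V, boxRatio E (T v) H
      ≤ ∑ v ∈ V, 2 ^ (Module.finrank ℚ K * m) * s v := by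
        refine Finset.sum_le_sum fun v hv => ?_
        simpa [T] using hU.boxRatio_forall_memFinite_le one_ne_zero hH (S := {v}) (by simp)
          (by simpa using ((hmem v).1 hv).1)
    _ ≤ _ := by
        rw [← Finset.mul_sum]
        gcongr
        rw [le_sub_iff_add_le, ← Finset.sum_union Finset.sdiff_disjoint]
        exact hU.summable.sum_le_tsum _ fun v _ => hU.nonneg v

theorem tendsto_tail (hU : U.IsCongruenceSieve E e s) :
    Tendsto (fun M : ℕ => 2 ^ (Module.finrank ℚ K * m) *
      (∑' v, s v - ∑ v ∈ primesUpTo K M, s v)) atTop (𝓝 0) := by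
  have h : Tendsto (fun M : ℕ => ∑ v ∈ primesUpTo K M, s v) atTop (𝓝 (∑' v, s v)) :=
    hU.summable.hasSum.comp (tendsto_primesUpTo.comp tendsto_natCast_atTop_atTop)
  simpa using (h.const_sub (∑' v, s v)).const_mul (2 ^ (Module.finrank ℚ K * m))

theorem tendsto_large_one_div (hU : U.IsCongruenceSieve E e s) : Tendsto (fun H : ℕ =>
    boxRatio E {a | ∃ v, (H : ℝ) ^ (1 / e : ℝ) < below v ∧ U.MemFinite v a} H) atTop (𝓝 0) :=
  hU.tendsto_large _ (one_div_pos.2 (Nat.cast_pos.2 (Nat.pos_of_ne_zero hU.exponent_ne_zero)))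

theorem tailCondition (hU : U.IsCongruenceSieve E e s) : U.TailCondition E := by
  refine squeeze_zero (fun M => ?_) (fun M => ?_) hU.tendsto_tail
  · refine le_limsup_of_frequently_le
      (Eventually.of_forall fun H => boxRatio_nonneg E _ H).frequently
      (isBoundedUnder_of ⟨1, boxRatio_le_one E _⟩)
  · have hlim := hU.tendsto_large_one_div.const_add (2 ^ (Module.finrank ℚ K * m) *
      (∑' v, s v - ∑ v ∈ primesUpTo K M, s v))
    rw [add_zero] at hlim
    rw [upperDensity, ← hlim.limsup_eq]
    refine limsup_le_limsup ?_ ?_ hlim.isBoundedUnder_le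
    · filter_upwards [eventually_ge_atTop 1] with H hH
      exact hU.boxRatio_exists_lt_below_le M hH
    · exact isCoboundedUnder_le_of_le (x := 0) _ fun H => boxRatio_nonneg E _ H

theorem momentConditions (hU : U.IsCongruenceSieve E e s) (hclopen : ∀ v, IsClopen (U.finite v))
    {n : ℕ} (hn : n ≠ 0) : U.MomentConditions E n where
  frontier_finite v := by
    rw [(hclopen v).frontier_eq]
    let : MeasurableSpace (Fin m → v.adicCompletionIntegers K) := borel _
    exact MeasureTheory.measure_empty
  frontier_infinite := by simp [hU.infinite_eq_empty]
  cone := by simp [hU.infinite_eq_empty]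
  tail := hU.tailCondition
  bounds := by
    have he := Nat.pos_of_ne_zero hU.exponent_ne_zero
    have := Nat.pos_of_ne_zero hn
    have hβ : (0 : ℝ) < 1 / (e * n : ℝ) := by positivity
    obtain ⟨c, hc⟩ := hU.encard_large_le _ hβ
    refine ⟨1 / (e * n : ℝ), 1, c + 1, hβ.le, ?_,
      fun v => 2 ^ (Module.finrank ℚ K * m) * s v, hU.summable.mul_left _, ?_⟩ <;>
      simp only [Int.cast_one, one_mul, hU.boxI_eq]
    · intro H hH a ha
      refine ⟨Set.finite_of_encard_le_coe (hc H hH a ha), Int.lt_add_one_iff.2 (mod_cast ?_)⟩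
      exact ENat.toNat_le_of_le_natCast (mod_cast hc H hH a ha)
    · intro H hH S hS hSn hSb
      have h := hU.boxRatio_forall_memFinite_le hn hH hSn hSb
      rw [boxRatio, div_le_iff₀ (boxSize_pos _ hH)] at h
      refine le_trans (by simpa only [Set.mem_ofPred_eq] using h) ?_
      rw [mul_comm, Finset.prod_mul_distrib, Finset.prod_const]
      have hone : (2 : ℝ) ^ (Module.finrank ℚ K * m) ≤
          (2 ^ (Module.finrank ℚ K * m)) ^ S.card :=
        le_self_pow₀ (one_le_pow₀ one_le_two) (Finset.card_ne_zero.2 hS)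
      have hs : 0 ≤ ∏ v ∈ S, s v := Finset.prod_nonneg fun v _ => hU.nonneg v
      gcongr
      exact boxSize_nonneg _ _

end IsCongruenceSieve

end LocalSystem

section Series

variable {ι : Type*} {s : ι → ℝ}

theorem multipliable_one_sub (hs : Summable s) : Multipliable fun i => 1 - s i := by
  simpa only [sub_eq_add_neg] using Real.multipliable_one_add_of_summable hs.neg

theorem tprod_one_sub_lt_one (hs : Summable s) (h0 : ∀ i, 0 ≤ s i) (h1 : ∀ i, s i ≤ 1) {j : ι}
    (hj : 0 < s j) : ∏' i, (1 - s i) < 1 := by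
  refine lt_of_le_of_lt (le_of_tendsto (multipliable_one_sub hs).hasProd ?_) (sub_lt_self 1 hj)
  filter_upwards [eventually_ge_atTop {j}] with S hS
  rw [← Finset.mul_prod_erase _ _ (Finset.singleton_subset_iff.1 hS)]
  refine mul_le_of_le_one_right (sub_nonneg.2 (h1 j)) ?_
  exact Finset.prod_le_one (fun i _ => sub_nonneg.2 (h1 i)) fun i _ => sub_le_self 1 (h0 i)

theorem diagonal_injective : Function.Injective fun i : ι => (i, i) :=
  fun _ _ h => (Prod.ext_iff.1 h).1

theorem summable_sq (hs : Summable s) (h0 : ∀ i, 0 ≤ s i) : Summable fun i => s i ^ 2 := by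
  simpa only [Function.comp_def, pow_two] using
    (hs.mul_of_nonneg hs h0 h0).comp_injective diagonal_injective

theorem hasSum_prod_image_fin_one (hs : Summable s) :
    HasSum (fun p : Fin 1 → ι => ∏ i ∈ Finset.univ.image p, s i) (∑' i, s i) := by
  rw [← (Equiv.funUnique (Fin 1) ι).symm.hasSum_iff]
  simpa [Function.comp_def] using hs.hasSum

theorem hasSum_prod_image_fin_two (hs : Summable s) (h0 : ∀ i, 0 ≤ s i) :
    HasSum (fun p : Fin 2 → ι => ∏ i ∈ Finset.univ.image p, s i)
      ((∑' i, s i) ^ 2 - ∑' i, s i ^ 2 + ∑' i, s i) := by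
  have hall : HasSum (fun p : ι × ι => s p.1 * s p.2) ((∑' i, s i) * ∑' i, s i) :=
    hs.hasSum.mul hs.hasSum (hs.mul_of_nonneg hs h0 h0)
  have hdiag : HasSum (fun p : ι × ι => if p.1 = p.2 then s p.1 - s p.1 ^ 2 else 0)
      (∑' i, s i - ∑' i, s i ^ 2) := by
    rw [← diagonal_injective.hasSum_iff fun p hp => if_neg fun h => hp ⟨p.1, Prod.ext rfl h⟩]
    simpa [Function.comp_def] using hs.hasSum.sub (summable_sq hs h0).hasSum
  rw [← (finTwoArrowEquiv ι).symm.hasSum_iff]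
  convert hall.add hdiag using 1
  · funext ⟨i, j⟩
    rcases eq_or_ne i j with rfl | hij
    · simp [Finset.image, Fin.univ_succ]
      ring
    · simp [Finset.image, Fin.univ_succ, hij, Finset.prod_pair hij]
  · ring

end Series

section Limits

theorem tendsto_of_abs_sub_le {f : ℕ → ℝ} {g : ℕ → ℕ → ℝ} {G r ε : ℕ → ℝ} {l : ℝ}
    (hg : ∀ M, Tendsto (g M) atTop (𝓝 (G M))) (hG : Tendsto G atTop (𝓝 l))
    (hr : Tendsto r atTop (𝓝 0)) (hε : Tendsto ε atTop (𝓝 0))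
    (h : ∀ M, ∀ᶠ H in atTop, |g M H - f H| ≤ r M + ε H) : Tendsto f atTop (𝓝 l) := by
  refine Metric.tendsto_nhds.2 fun δ hδ => ?_
  have hδ' : 0 < δ / 4 := by positivity
  obtain ⟨M, hGM, hrM⟩ :=
    ((Metric.tendsto_nhds.1 hG _ hδ').and (Metric.tendsto_nhds.1 hr _ hδ')).exists
  filter_upwards [Metric.tendsto_nhds.1 (hg M) _ hδ', Metric.tendsto_nhds.1 hε _ hδ', h M]
    with H hgH hεH hH
  simp only [Real.dist_eq, sub_zero, abs_lt, abs_le] at *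
  constructor <;> linarith

theorem tendsto_of_le_of_forall_le_mul_add {f g w : ℕ → ℝ} {l : ℝ} (n : ℕ)
    (hf : Tendsto f atTop (𝓝 l)) (hw : Tendsto w atTop (𝓝 0)) (hfg : ∀ᶠ H in atTop, f H ≤ g H)
    (h : ∀ δ : ℝ, 0 < δ → ∃ C : ℝ, ∀ᶠ H in atTop, g H ≤ (1 + δ) ^ n * f H + C * w H) :
    Tendsto g atTop (𝓝 l) := by
  refine tendsto_order.2 ⟨fun b hb => ?_, fun b hb => ?_⟩
  · filter_upwards [hf.eventually_const_lt hb, hfg] with H hbH hH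
    exact hbH.trans_le hH
  · have hcont : Tendsto (fun δ : ℝ => (1 + δ) ^ n * l) (𝓝[>] 0) (𝓝 l) := by
      have : Continuous fun δ : ℝ => (1 + δ) ^ n * l := by fun_prop
      simpa using (this.tendsto 0).mono_left nhdsWithin_le_nhds
    obtain ⟨δ, hδb, hδ⟩ := ((hcont.eventually_lt_const hb).and self_mem_nhdsWithin).exists
    obtain ⟨C, hC⟩ := h δ hδ
    have hlim : Tendsto (fun H => (1 + δ) ^ n * f H + C * w H) atTop (𝓝 ((1 + δ) ^ n * l)) := by
      simpa using (hf.const_mul ((1 + δ) ^ n)).add (hw.const_mul C)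
    filter_upwards [hlim.eventually_lt_const hδb, hC] with H hbH hH
    exact hH.trans_lt hbH

theorem add_pow_le_mul_pow_add {x c δ : ℝ} (hx : 0 ≤ x) (hc : 0 ≤ c) (hδ : 0 < δ) (n : ℕ) :
    (x + c) ^ n ≤ (1 + δ) ^ n * x ^ n + (c / δ + c) ^ n := by
  rcases le_total x (c / δ) with h | h
  · exact (pow_le_pow_left₀ (by positivity) (by gcongr) n).trans
      (le_add_of_nonneg_left (by positivity))
  · rw [div_le_iff₀ hδ] at h
    rw [← mul_pow]
    exact (pow_le_pow_left₀ (by positivity) (by linarith) n).trans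
      (le_add_of_nonneg_right (by positivity))

theorem sum_card_filter_pow {α β : Type*} (A : Finset α) (B : Finset β) (r : β → α → Prop)
    (n : ℕ) :
    ∑ a ∈ A, (B.filter (r · a)).card ^ n =
      ∑ p ∈ Fintype.piFinset fun _ : Fin n => B,
        (A.filter fun a => ∀ i, r (p i) a).card := by
  have hpow (a) : (B.filter (r · a)).card ^ n =
      ((Fintype.piFinset fun _ : Fin n => B).filter fun p => ∀ i, r (p i) a).card := by
    rw [← Fintype.card_piFinset_const]
    congr 1
    ext p
    simp [forall_and]
  simp only [hpow]
  exact Finset.sum_card_bipartiteAbove_eq_sum_card_bipartiteBelow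
    fun a (p : Fin n → β) => ∀ i, r (p i) a

end Limits

namespace LocalSystem.IsCongruenceSieve

variable {K : Type*} [Field K] [NumberField K] {m : ℕ} {U : LocalSystem K m} {E : IntegralBasis K}
  {e : ℕ} {s : HeightOneSpectrum (𝓞 K) → ℝ}

theorem hasDensity_places_eq_empty (hU : U.IsCongruenceSieve E e s) :
    HasDensity E {a | U.places a = ∅} (∏' v, (1 - s v)) := by
  have hmem (a : Fin m → 𝓞 K) : U.places a = ∅ ↔ ∀ v, ¬ U.MemFinite v a := by
    rw [hU.places_eq, Set.image_eq_empty, Set.eq_empty_iff_forall_notMem]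
    rfl
  refine tendsto_of_abs_sub_le
    (fun M => hU.hasDensity_forall_not_memFinite (primesUpTo K (M : ℕ)))
    ((multipliable_one_sub hU.summable).hasProd.comp
      (tendsto_primesUpTo.comp tendsto_natCast_atTop_atTop))
    hU.tendsto_tail hU.tendsto_large_one_div fun M => ?_
  filter_upwards [eventually_ge_atTop 1] with H hH
  have hle := boxRatio_mono E (T := {a | U.places a = ∅})
    (T' := {a | ∀ v ∈ primesUpTo K M, ¬ U.MemFinite v a}) (fun a ha v _ => (hmem a).1 ha v) H
  have hge : boxRatio E {a | ∀ v ∈ primesUpTo K M, ¬ U.MemFinite v a} H ≤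
      boxRatio E {a | U.places a = ∅} H +
        boxRatio E {a | ∃ v, M < below v ∧ U.MemFinite v a} H := by
    refine (boxRatio_mono E (fun a ha => ?_) H).trans (boxRatio_union_le E _ _ H)
    refine or_iff_not_imp_right.2 fun hsmall => (hmem a).2 fun v hv => ?_
    exact ha v (mem_primesUpTo.2 (Nat.cast_le.2 (not_lt.1 fun h => hsmall ⟨v, h, hv⟩))) hv
  rw [abs_of_nonneg (sub_nonneg.2 hle), sub_le_iff_le_add']
  exact hge.trans (add_le_add_right (hU.boxRatio_exists_lt_below_le M hH) _)

theorem tendsto_sum_card_primesUpTo_pow (hU : U.IsCongruenceSieve E e s) {n : ℕ} (hn : n ≠ 0)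
    {l : ℝ} (hl : HasSum (fun p : Fin n → HeightOneSpectrum (𝓞 K) =>
      ∏ v ∈ Finset.univ.image p, s v) l) :
    Tendsto (fun H : ℕ => (∑ a ∈ box E m H, (((primesUpTo K ((H : ℝ) ^ (1 / (e * n : ℝ)))).filter
      (U.MemFinite · a)).card : ℝ) ^ n) / boxSize K m H) atTop (𝓝 l) := by
  set P := fun H : ℕ => primesUpTo K ((H : ℝ) ^ (1 / (e * n : ℝ)))
  have he := Nat.pos_of_ne_zero hU.exponent_ne_zero
  have := Nat.pos_of_ne_zero hn
  have hsum (H : ℕ) :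
      (∑ a ∈ box E m H, (((P H).filter (U.MemFinite · a)).card : ℝ) ^ n) / boxSize K m H =
        ∑' p : Fin n → HeightOneSpectrum (𝓞 K), if ∀ i, p i ∈ P H then
          boxRatio E {a | ∀ v ∈ Finset.univ.image p, U.MemFinite v a} H else 0 := by
    rw [tsum_eq_sum (s := Fintype.piFinset fun _ => P H) fun p hp =>
      if_neg fun h => hp (Fintype.mem_piFinset.2 h)]
    rw [Finset.sum_congr rfl fun p hp => if_pos (Fintype.mem_piFinset.1 hp)]
    have hcard := congrArg (Nat.cast (R := ℝ)) (sum_card_filter_pow (box E m H) (P H) U.MemFinite n)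
    push_cast at hcard
    simp only [boxRatio, ← Finset.sum_div, hcard, Finset.forall_mem_image, Finset.mem_univ,
      true_imp_iff, Set.mem_ofPred_eq]
  rw [← hl.tsum_eq]
  refine Tendsto.congr (fun H => (hsum H).symm) ?_
  refine tendsto_tsum_of_dominated_convergence
    (hl.summable.mul_left (2 ^ (Module.finrank ℚ K * m))) (fun p => ?_) ?_
  · refine (hU.hasDensity_forall_memFinite (Finset.univ.image p)).congr' ?_
    have hPtop : Tendsto P atTop atTop := tendsto_primesUpTo.comp
      ((tendsto_rpow_atTop (by positivity)).comp tendsto_natCast_atTop_atTop)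
    filter_upwards [hPtop.eventually_ge_atTop (Finset.univ.image p)] with H hH
    rw [if_pos fun i => hH (Finset.mem_image_of_mem p (Finset.mem_univ i))]
  · filter_upwards [eventually_ge_atTop 1] with H hH p
    have hs : 0 ≤ ∏ v ∈ Finset.univ.image p, s v := Finset.prod_nonneg fun v _ => hU.nonneg v
    split_ifs with hp
    · rw [Real.norm_of_nonneg (boxRatio_nonneg E _ H)]
      refine hU.boxRatio_forall_memFinite_le hn hH
        (Finset.card_image_le.trans (Finset.card_fin n).le) fun v hv => ?_
      obtain ⟨i, -, rfl⟩ := Finset.mem_image.1 hv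
      exact mem_primesUpTo.1 (hp i)
    · rw [norm_zero]
      positivity

theorem ncard_places_eq (hU : U.IsCongruenceSieve E e s) (x : ℝ) (a : Fin m → 𝓞 K) :
    (U.places a).ncard = ((primesUpTo K x).filter (U.MemFinite · a)).card +
      {v | x < below v ∧ U.MemFinite v a}.ncard := by
  have hfin := hU.finite_setOf_memFinite a
  rw [hU.places_eq, Set.ncard_image_of_injective _ (Option.some_injective _),
    ← Set.ncard_coe_finset, ← Set.ncard_union_eq _ (Finset.finite_toSet _)
      (hfin.subset fun v hv => hv.2)]
  · congr 1
    ext v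
    simp only [Finset.coe_filter, mem_primesUpTo, Set.mem_ofPred_eq, Set.mem_union, ← or_and_right,
      le_or_gt, true_and]
  · exact Set.disjoint_left.2 fun v hv hv' =>
      hv'.1.not_ge (mem_primesUpTo.1 (Finset.mem_filter.1 hv).1)

theorem exists_forall_sum_ncard_places_pow_le (hU : U.IsCongruenceSieve E e s) {β : ℝ}
    (hβ : 0 < β) (n : ℕ) {δ : ℝ} (hδ : 0 < δ) : ∃ C : ℝ, ∀ H : ℕ, 1 ≤ H →
      ∑ a ∈ box E m H, ((U.places a).ncard : ℝ) ^ n ≤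
        (1 + δ) ^ n * ∑ a ∈ box E m H,
          (((primesUpTo K ((H : ℝ) ^ β)).filter (U.MemFinite · a)).card : ℝ) ^ n +
        C * ((box E m H).filter
          (· ∈ {a | ∃ v, (H : ℝ) ^ β < below v ∧ U.MemFinite v a})).card := by
  obtain ⟨c, hc⟩ := hU.encard_large_le β hβ
  refine ⟨(c / δ + c) ^ n, fun H hH => ?_⟩
  rw [Finset.mul_sum, mul_comm ((c / δ + c : ℝ) ^ n), ← nsmul_eq_mul, ← Finset.sum_const,
    Finset.sum_filter, ← Finset.sum_add_distrib]
  refine Finset.sum_le_sum fun a ha => ?_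
  rw [hU.ncard_places_eq ((H : ℝ) ^ β)]
  set x := ((primesUpTo K ((H : ℝ) ^ β)).filter (U.MemFinite · a)).card
  split_ifs with hlarge
  · have hle : {v | (H : ℝ) ^ β < below v ∧ U.MemFinite v a}.ncard ≤ c :=
      ENat.toNat_le_of_le_natCast (hc H hH a ha)
    refine le_trans ?_ (add_pow_le_mul_pow_add x.cast_nonneg c.cast_nonneg hδ n)
    exact_mod_cast Nat.pow_le_pow_left (Nat.add_le_add_left hle x) n
  · have hempty : {v | (H : ℝ) ^ β < below v ∧ U.MemFinite v a} = ∅ :=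
      Set.eq_empty_iff_forall_notMem.2 fun v hv => hlarge ⟨v, hv⟩
    rw [hempty, Set.ncard_empty, add_zero, add_zero]
    exact le_mul_of_one_le_left (by positivity) (one_le_pow₀ (by linarith))

theorem hasMoment (hU : U.IsCongruenceSieve E e s) {n : ℕ} (hn : n ≠ 0) {l : ℝ}
    (hl : HasSum (fun p : Fin n → HeightOneSpectrum (𝓞 K) =>
      ∏ v ∈ Finset.univ.image p, s v) l) : U.HasMoment E n l := by
  have he := Nat.pos_of_ne_zero hU.exponent_ne_zero
  have := Nat.pos_of_ne_zero hn
  have hβ : (0 : ℝ) < 1 / (e * n : ℝ) := by positivity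
  rw [HasMoment]
  simp only [hU.boxI_eq]
  refine tendsto_of_le_of_forall_le_mul_add n (hU.tendsto_sum_card_primesUpTo_pow hn hl)
    (hU.tendsto_large _ hβ) (Eventually.of_forall fun H => ?_) fun δ hδ => ?_
  · refine div_le_div_of_nonneg_right (Finset.sum_le_sum fun a _ => ?_) (boxSize_nonneg m H)
    rw [hU.ncard_places_eq ((H : ℝ) ^ (1 / (e * n : ℝ)))]
    gcongr
    exact Nat.le_add_right _ _
  · obtain ⟨C, hC⟩ := hU.exists_forall_sum_ncard_places_pow_le hβ n hδ
    refine ⟨C, ?_⟩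
    filter_upwards [eventually_ge_atTop 1] with H hH
    rw [boxRatio, ← mul_div_assoc, ← mul_div_assoc, ← add_div]
    exact div_le_div_of_nonneg_right (hC H hH) (boxSize_nonneg m H)

end LocalSystem.IsCongruenceSieve

namespace LocalSystem

variable {K : Type*} [Field K] [NumberField K] {m : ℕ} {U : LocalSystem K m}
  {T : Set (Fin m → 𝓞 K)}

theorem sum_filter_ncard_places_pow (hT : Tᶜ = {a | U.places a = ∅}) {n : ℕ} (hn : n ≠ 0)
    (A : Finset (Fin m → 𝓞 K)) :
    ∑ a ∈ A.filter (· ∈ T), ((U.places a).ncard : ℝ) ^ n =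
      ∑ a ∈ A, ((U.places a).ncard : ℝ) ^ n := by
  refine Finset.sum_filter_of_ne fun a _ ha => not_not.1 fun haT => ha ?_
  have hempty : U.places a = ∅ := hT.subset haT
  rw [hempty, Set.ncard_empty, Nat.cast_zero, zero_pow hn]

theorem sum_filter_ncard_places_sub_sq (hT : Tᶜ = {a | U.places a = ∅}) (t : ℝ)
    (A : Finset (Fin m → 𝓞 K)) :
    ∑ a ∈ A.filter (· ∈ T), ((U.places a).ncard - t) ^ 2 =
      ∑ a ∈ A, ((U.places a).ncard : ℝ) ^ 2 - 2 * t * ∑ a ∈ A, ((U.places a).ncard : ℝ) ^ 1 +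
        t ^ 2 * (A.filter (· ∈ T)).card := by
  rw [← sum_filter_ncard_places_pow hT one_ne_zero, ← sum_filter_ncard_places_pow hT two_ne_zero,
    Finset.mul_sum, ← Finset.sum_sub_distrib, mul_comm (t ^ 2), ← nsmul_eq_mul,
    ← Finset.sum_const, ← Finset.sum_add_distrib]
  exact Finset.sum_congr rfl fun a _ => by ring

namespace IsCongruenceSieve

variable {E : IntegralBasis K} {e : ℕ} {s : HeightOneSpectrum (𝓞 K) → ℝ}

theorem correspondsTo (hU : U.IsCongruenceSieve E e s) (hT : Tᶜ = {a | U.places a = ∅}) :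
    U.CorrespondsTo E T :=
  ⟨hU.tailCondition, hT⟩

theorem hasDensity (hU : U.IsCongruenceSieve E e s) (hT : Tᶜ = {a | U.places a = ∅}) :
    HasDensity E T (1 - ∏' v, (1 - s v)) := by
  rw [← compl_compl T, hT]
  exact hU.hasDensity_places_eq_empty.compl

theorem hasMoment_one (hU : U.IsCongruenceSieve E e s) : U.HasMoment E 1 (∑' v, s v) :=
  hU.hasMoment one_ne_zero (hasSum_prod_image_fin_one hU.summable)

theorem hasMoment_two (hU : U.IsCongruenceSieve E e s) :
    U.HasMoment E 2 ((∑' v, s v) ^ 2 - ∑' v, s v ^ 2 + ∑' v, s v) :=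
  hU.hasMoment two_ne_zero (hasSum_prod_image_fin_two hU.summable hU.nonneg)

theorem hasRestrictedMoment (hU : U.IsCongruenceSieve E e s) (hT : Tᶜ = {a | U.places a = ∅})
    {ρ : ℝ} (hρ : ρ ≠ 0) (hdens : HasDensity E T ρ) {n : ℕ} (hn : n ≠ 0) {l : ℝ}
    (hl : U.HasMoment E n l) : U.HasRestrictedMoment E T n (ρ⁻¹ * l) := by
  rw [inv_mul_eq_div]
  refine (Tendsto.div hl hdens hρ).congr' ?_
  filter_upwards [eventually_ge_atTop 1] with H hH
  simp only [hU.boxI_eq, Pi.div_apply, boxRatio]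
  rw [sum_filter_ncard_places_pow hT hn, div_div_div_cancel_right₀ (boxSize_pos _ hH).ne']

theorem hasRestrictedVariance (hU : U.IsCongruenceSieve E e s) (hT : Tᶜ = {a | U.places a = ∅})
    {ρ : ℝ} (hρ : ρ ≠ 0) (hdens : HasDensity E T ρ) {μ μ₂ : ℝ} (hμ : U.HasMoment E 1 μ)
    (hμ₂ : U.HasMoment E 2 μ₂) :
    U.HasRestrictedVariance E T (1 / ρ * μ₂ - 2 * (ρ⁻¹ * μ) / ρ * μ + (ρ⁻¹ * μ) ^ 2) := by
  refine ⟨ρ⁻¹ * μ, hU.hasRestrictedMoment hT hρ hdens one_ne_zero hμ, ?_⟩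
  set t := ρ⁻¹ * μ
  have hval : 1 / ρ * μ₂ - 2 * t / ρ * μ + t ^ 2 = (μ₂ - 2 * t * μ + t ^ 2 * ρ) / ρ := by
    field_simp
  rw [hval]
  refine (Tendsto.div ((Tendsto.sub hμ₂ (Tendsto.const_mul (2 * t) hμ)).add
    (Tendsto.const_mul (t ^ 2) hdens)) hdens hρ).congr' ?_
  filter_upwards [eventually_ge_atTop 1] with H hH
  simp only [hU.boxI_eq, Pi.div_apply, boxRatio]
  rw [sum_filter_ncard_places_sub_sq hT, ← mul_div_assoc, ← mul_div_assoc, ← sub_div, ← add_div,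
    div_div_div_cancel_right₀ (boxSize_pos _ hH).ne']

end IsCongruenceSieve

end LocalSystem

section PairSieve

variable {K : Type*} [Field K] [NumberField K] (E : IntegralBasis K) {m : ℕ}
  {F G D : (Fin m → 𝓞 K) → 𝓞 K} {i j : Fin m} {β : ℝ} {C e : ℕ}

theorem boxRatio_eq_zero_le
    (hG : ∀ a x y, G (Function.update a i x) - G (Function.update a i y) = D a * (x - y))
    {H : ℕ} (hH : 1 ≤ H) : boxRatio E {a | D a ≠ 0 ∧ G a = 0} H ≤ (2 * H : ℝ)⁻¹ := by
  have hH' : (1 : ℝ) ≤ 2 * H := by exact_mod_cast (by omega : 1 ≤ 2 * H)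
  refine boxRatio_le_of_update E i (by positivity) hH fun a _ ha => ?_
  have hone : ((intBox E H).filter fun x =>
      Function.update a i x ∈ {a | D a ≠ 0 ∧ G a = 0}).card ≤ 1 := by
    refine Finset.card_le_one.2 fun x hx y hy => ?_
    have h := hG a x y
    rw [(Finset.mem_filter.1 hx).2.2, (Finset.mem_filter.1 hy).2.2, sub_zero, eq_comm] at h
    exact sub_eq_zero.1 ((mul_eq_zero.1 h).resolve_left ha.1)
  calc _ ≤ (1 : ℝ) := mod_cast hone
    _ ≤ (2 * H : ℝ)⁻¹ * (2 * H) ^ Module.finrank ℚ K := by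
      rw [← div_eq_inv_mul, one_le_div (by positivity)]
      exact le_self_pow₀ hH' Module.finrank_pos.ne'

theorem card_filter_update_mem_le
    (hG : ∀ a x y, G (Function.update a i x) - G (Function.update a i y) = D a * (x - y))
    (a : Fin m → 𝓞 K) {v : HeightOneSpectrum (𝓞 K)} {H : ℕ} (hH : 1 ≤ H)
    (hv : (H : ℝ) ^ β < below v) :
    (((intBox E H).filter fun x => G (Function.update a i x) ∈ v.asIdeal ∧
      D (Function.update a i x) ∉ v.asIdeal).card : ℝ) ≤
        (((H : ℝ) ^ β)⁻¹ + (2 * H : ℝ)⁻¹) * (2 * H) ^ Module.finrank ℚ K := by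
  have hD (x : 𝓞 K) : D (Function.update a i x) = D a := by
    simpa using (hG (Function.update a i x) 1 0).symm.trans (by simpa using hG a 1 0)
  refine (card_le_of_sub_mem_asIdeal E v hH (Finset.filter_subset _ _)
    fun x hx y hy => ?_).trans ?_
  · have hx' := (Finset.mem_filter.1 hx).2
    have hmem := sub_mem hx'.1 (Finset.mem_filter.1 hy).2.1
    rw [hG] at hmem
    exact (v.isPrime.mem_or_mem hmem).resolve_left (hD x ▸ hx'.2)
  · have : (0 : ℝ) < (H : ℝ) ^ β := by positivity
    gcongr

theorem exists_boxRatio_exists_mem_le (hβ : 0 < β)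
    (hnorm : ∀ H : ℕ, 1 ≤ H → ∀ a ∈ box E m H, Ideal.absNorm (Ideal.span {F a}) ≤ C * H ^ e)
    (hFi : ∀ a x, F (Function.update a i x) = F a)
    (hG : ∀ a x y, G (Function.update a i x) - G (Function.update a i y) = D a * (x - y)) :
    ∃ c : ℕ, ∀ H : ℕ, 1 ≤ H → boxRatio E {a | F a ≠ 0 ∧ ∃ v : HeightOneSpectrum (𝓞 K),
      (H : ℝ) ^ β < below v ∧ F a ∈ v.asIdeal ∧ G a ∈ v.asIdeal ∧ D a ∉ v.asIdeal} H ≤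
        c * (((H : ℝ) ^ β)⁻¹ + (2 * H : ℝ)⁻¹) := by
  obtain ⟨c, hc⟩ := exists_encard_le_of_absNorm_le K hβ C e
  refine ⟨c, fun H hH => boxRatio_le_of_update E i (by positivity) hH fun a hbox ha => ?_⟩
  have hcard := hc H hH (F a) ha.1 (hnorm H hH a hbox)
  have hfin := Set.finite_of_encard_le_coe hcard
  rw [hfin.encard_eq_coe_toFinset_card, Nat.cast_le] at hcard
  set V := hfin.toFinset
  let W (v : HeightOneSpectrum (𝓞 K)) := (intBox E H).filter fun x =>
    G (Function.update a i x) ∈ v.asIdeal ∧ D (Function.update a i x) ∉ v.asIdeal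
  have hcover : (intBox E H).filter (fun x => Function.update a i x ∈ {a | F a ≠ 0 ∧
      ∃ v : HeightOneSpectrum (𝓞 K), (H : ℝ) ^ β < below v ∧ F a ∈ v.asIdeal ∧
        G a ∈ v.asIdeal ∧ D a ∉ v.asIdeal}) ⊆ V.biUnion W := by
    intro x hx
    obtain ⟨hxH, -, v, hv, hFv, hGv⟩ := Finset.mem_filter.1 hx
    exact Finset.mem_biUnion.2 ⟨v, hfin.mem_toFinset.2 ⟨hv, hFi a x ▸ hFv⟩,
      Finset.mem_filter.2 ⟨hxH, hGv⟩⟩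
  calc _ ≤ ∑ v ∈ V, ((W v).card : ℝ) :=
        mod_cast (Finset.card_le_card hcover).trans Finset.card_biUnion_le
    _ ≤ ∑ _v ∈ V, (((H : ℝ) ^ β)⁻¹ + (2 * H : ℝ)⁻¹) * (2 * H) ^ Module.finrank ℚ K :=
        Finset.sum_le_sum fun v hv =>
          card_filter_update_mem_le E hG a hH (hfin.mem_toFinset.1 hv).1
    _ ≤ _ := by
        rw [Finset.sum_const, nsmul_eq_mul, ← mul_assoc]
        gcongr

theorem tendsto_boxRatio_exists_mem (hβ : 0 < β)
    (hnorm : ∀ H : ℕ, 1 ≤ H → ∀ a ∈ box E m H, Ideal.absNorm (Ideal.span {F a}) ≤ C * H ^ e)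
    (hFi : ∀ a x, F (Function.update a i x) = F a)
    (hFj : ∀ a x y, F (Function.update a j x) - F (Function.update a j y) = D a * (x - y))
    (hG : ∀ a x y, G (Function.update a i x) - G (Function.update a i y) = D a * (x - y)) :
    Tendsto (fun H : ℕ => boxRatio E {a | ∃ v : HeightOneSpectrum (𝓞 K),
      (H : ℝ) ^ β < below v ∧ F a ∈ v.asIdeal ∧ G a ∈ v.asIdeal ∧ D a ∉ v.asIdeal} H)
      atTop (𝓝 0) := by
  obtain ⟨c, hc⟩ := exists_boxRatio_exists_mem_le E hβ hnorm hFi hG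
  have hpow : Tendsto (fun H : ℕ => ((H : ℝ) ^ β)⁻¹) atTop (𝓝 0) :=
    ((tendsto_rpow_atTop hβ).comp tendsto_natCast_atTop_atTop).inv_tendsto_atTop
  have hinv : Tendsto (fun H : ℕ => (2 * H : ℝ)⁻¹) atTop (𝓝 0) :=
    (tendsto_natCast_atTop_atTop.const_mul_atTop two_pos).inv_tendsto_atTop
  have hlim : Tendsto (fun H : ℕ => (2 * H : ℝ)⁻¹ + c * (((H : ℝ) ^ β)⁻¹ + (2 * H : ℝ)⁻¹))
      atTop (𝓝 0) := by
    simpa using hinv.add ((hpow.add hinv).const_mul (c : ℝ))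
  refine squeeze_zero' (Eventually.of_forall fun H => boxRatio_nonneg E _ H) ?_ hlim
  filter_upwards [eventually_ge_atTop 1] with H hH
  refine (boxRatio_mono E ?_ H).trans ((boxRatio_union_le E _ _ H).trans
    (add_le_add (boxRatio_eq_zero_le E hFj hH) (hc H hH)))
  rintro a ⟨v, hv, hFv, hGv, hDv⟩
  by_cases hF : F a = 0
  · exact Or.inl ⟨fun h => hDv (h ▸ zero_mem _), hF⟩
  · exact Or.inr ⟨hF, v, hv, hFv, hGv, hDv⟩

end PairSieve

section Heights

variable {K : Type*} [Field K] [NumberField K] (E : IntegralBasis K)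

theorem exists_norm_embedding_le : ∃ A : ℝ, 0 ≤ A ∧ ∀ H : ℕ, ∀ x ∈ intBox E H,
    ∀ σ : K →ₐ[ℚ] ℂ, ‖σ (x : K)‖ ≤ A * H := by
  refine ⟨∑ σ : K →ₐ[ℚ] ℂ, ∑ j, ‖σ (E j : K)‖, by positivity, fun H x hx σ => ?_⟩
  rw [intBox_eq_coordBox, mem_coordBox] at hx
  have hexp : σ (x : K) = ∑ j, (E.repr x j : ℂ) * σ (E j : K) := by
    conv_lhs => rw [← E.sum_repr x]
    simp
  calc ‖σ (x : K)‖ ≤ ∑ j, ‖(E.repr x j : ℂ) * σ (E j : K)‖ := hexp ▸ norm_sum_le _ _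
    _ ≤ ∑ j, ‖σ (E j : K)‖ * H := by
        refine Finset.sum_le_sum fun j _ => ?_
        have hj := Finset.mem_Ico.1 (hx j)
        have hcoord : |(E.repr x j : ℝ)| ≤ H := mod_cast abs_le.2 ⟨hj.1, hj.2.le⟩
        rw [norm_mul, Complex.norm_intCast, mul_comm]
        gcongr
    _ ≤ _ := by
        rw [← Finset.sum_mul]
        gcongr
        exact Finset.single_le_sum (f := fun σ : K →ₐ[ℚ] ℂ => ∑ j, ‖σ (E j : K)‖)
          (fun _ _ => by positivity) (Finset.mem_univ σ)

theorem norm_coeff_powerDefect_le {d : ℕ} (hd : 1 ≤ d) {f : ℂ[X]} {B : ℝ}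
    (hf : ∀ i, ‖f.coeff i‖ ≤ B) {j : ℕ} (hj : j ≤ d) :
    ‖(powerDefect d f).coeff j‖ ≤ (d ^ d + 2 ^ d * d ^ d) * B ^ d := by
  have hB : 0 ≤ B := (norm_nonneg _).trans (hf 0)
  have hfst : ‖(d : ℂ) ^ d * f.coeff d ^ (d - 1) * f.coeff j‖ ≤ d ^ d * B ^ d := by
    rw [norm_mul, norm_mul, norm_pow, norm_pow, Complex.norm_natCast, mul_assoc,
      ← Nat.sub_add_cancel hd, pow_succ B, Nat.sub_add_cancel hd]
    gcongr <;> apply hf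
  have hsnd : ‖(d.choose j : ℂ) * (d * f.coeff d) ^ j * f.coeff (d - 1) ^ (d - j)‖ ≤
      2 ^ d * (d ^ d * B ^ d) := by
    have hchoose : (d.choose j : ℝ) ≤ 2 ^ d := mod_cast Nat.choose_le_two_pow d j
    have hpow : (d : ℝ) ^ j ≤ d ^ d := pow_le_pow_right₀ (mod_cast hd) hj
    have hprod : ‖f.coeff d‖ ^ j * ‖f.coeff (d - 1)‖ ^ (d - j) ≤ B ^ d := by
      rw [← Nat.add_sub_cancel' hj, pow_add, Nat.add_sub_cancel' hj]
      gcongr <;> apply hf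
    rw [norm_mul, norm_mul, norm_pow, norm_pow, norm_mul, Complex.norm_natCast,
      Complex.norm_natCast, mul_assoc, mul_pow, mul_assoc]
    gcongr
  rw [coeff_powerDefect]
  calc _ ≤ d ^ d * B ^ d + 2 ^ d * (d ^ d * B ^ d) := (norm_sub_le _ _).trans (by gcongr)
    _ = _ := by ring

theorem exists_absNorm_coeff_powerDefect_le {d : ℕ} (hd : 1 ≤ d) : ∃ C : ℕ, ∀ H : ℕ, 1 ≤ H →
    ∀ a ∈ box E (d + 1) H, ∀ j ≤ d,
      Ideal.absNorm (Ideal.span {(powerDefect d (toPoly a)).coeff j}) ≤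
        C * H ^ (d * Module.finrank ℚ K) := by
  obtain ⟨A, hA, hbound⟩ := exists_norm_embedding_le E
  obtain ⟨C, hC⟩ := exists_nat_ge (((d ^ d + 2 ^ d * d ^ d) * A ^ d : ℝ) ^ Module.finrank ℚ K)
  refine ⟨C, fun H hH a ha j hj => ?_⟩
  have hconj (σ : K →ₐ[ℚ] ℂ) : ‖σ ((powerDefect d (toPoly a)).coeff j)‖ ≤
      (d ^ d + 2 ^ d * d ^ d) * A ^ d * (H : ℝ) ^ d := by
    let φ : 𝓞 K →+* ℂ := (σ : K →+* ℂ).comp (algebraMap (𝓞 K) K)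
    have hcoeff (i : ℕ) : ‖((toPoly a).map φ).coeff i‖ ≤ A * H := by
      rw [coeff_map]
      rcases lt_or_ge i (d + 1) with hi | hi
      · rw [show i = ((⟨i, hi⟩ : Fin (d + 1)) : ℕ) from rfl, coeff_toPoly]
        exact hbound H _ (Fintype.mem_piFinset.1 ha _) σ
      · rw [coeff_eq_zero_of_natDegree_lt ((natDegree_toPoly_le a).trans_lt hi), map_zero,
          norm_zero]
        positivity
    rw [mul_assoc _ (A ^ d), ← mul_pow A]
    convert norm_coeff_powerDefect_le hd hcoeff hj
    rw [← map_powerDefect, coeff_map]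
    rfl
  have hnorm : (Ideal.absNorm (Ideal.span {(powerDefect d (toPoly a)).coeff j}) : ℝ) ≤
      C * H ^ (d * Module.finrank ℚ K) := by
    rw [absNorm_span_singleton_eq_prod_embeddings]
    refine (Finset.prod_le_prod (fun _ _ => norm_nonneg _) fun σ _ => hconj σ).trans ?_
    rw [Finset.prod_const, Finset.card_univ, AlgHom.card, mul_pow, pow_mul]
    gcongr
  exact_mod_cast hnorm

end Heights

section PowerDefectUpdate

variable {R : Type*} [CommRing R] {d : ℕ}

theorem coeff_toPoly_update (a : Fin (d + 1) → R) (i : Fin (d + 1)) (x : R) (j : ℕ) :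
    (toPoly (Function.update a i x)).coeff j = if j = i then x else (toPoly a).coeff j := by
  rcases lt_or_ge j (d + 1) with hj | hj
  · lift j to Fin (d + 1) using hj
    simp only [coeff_toPoly, Function.update_apply, Fin.val_inj]
  · rw [if_neg (by omega), coeff_eq_zero_of_natDegree_lt ((natDegree_toPoly_le _).trans_lt hj),
      coeff_eq_zero_of_natDegree_lt ((natDegree_toPoly_le _).trans_lt hj)]

theorem coeff_powerDefect_update_of_ne (a : Fin (d + 1) → R) {i : Fin (d + 1)} {j : ℕ}
    (hi : (i : ℕ) + 1 < d) (hij : j ≠ i) (x : R) :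
    (powerDefect d (toPoly (Function.update a i x))).coeff j =
      (powerDefect d (toPoly a)).coeff j := by
  simp only [coeff_powerDefect, coeff_toPoly_update, if_neg hij, if_neg (show d ≠ i by omega),
    if_neg (show d - 1 ≠ i by omega)]

theorem coeff_powerDefect_update_sub (a : Fin (d + 1) → R) {i : Fin (d + 1)}
    (hi : (i : ℕ) + 1 < d) (x y : R) :
    (powerDefect d (toPoly (Function.update a i x))).coeff i -
        (powerDefect d (toPoly (Function.update a i y))).coeff i =
      (d : R) ^ d * a (Fin.last d) ^ (d - 1) * (x - y) := by
  simp only [coeff_powerDefect, coeff_toPoly_update, if_neg (show d ≠ i by omega),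
    if_neg (show d - 1 ≠ i by omega), if_true]
  rw [coeff_toPoly_last]
  ring

end PowerDefectUpdate

section Completion

variable {R : Type*} [CommRing R] [IsDedekindDomain R] (K : Type*) [Field K] [Algebra R K]
  [IsFractionRing R K] (v : HeightOneSpectrum R)

/-- The ideal `𝔭𝔬_𝔭` of the completed local ring `𝔬_𝔭`. -/
abbrev completedIdeal : Ideal (v.adicCompletionIntegers K) :=
  v.asIdeal.map (algebraMap R (v.adicCompletionIntegers K))

theorem valued_algebraMap (a : R) :
    Valued.v (algebraMap R (v.adicCompletionIntegers K) a : v.adicCompletion K) =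
      v.intValuation a := by
  rw [HeightOneSpectrum.algebraMap_adicCompletionIntegers_apply,
    HeightOneSpectrum.valuedAdicCompletion_eq_valuation', HeightOneSpectrum.valuation_of_algebraMap]

variable {K} in
theorem dvd_iff_valued_le {x y : v.adicCompletionIntegers K} :
    x ∣ y ↔ Valued.v (y : v.adicCompletion K) ≤ Valued.v (x : v.adicCompletion K) :=
  (HeightOneSpectrum.adicCompletionIntegers.integers K v).dvd_iff_le

variable {v} in
theorem completedIdeal_pow_eq_span {π : R} (hπ : v.intValuation π = WithZero.exp (-1 : ℤ)) (j : ℕ) :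
    completedIdeal K v ^ j = Ideal.span {algebraMap R (v.adicCompletionIntegers K) (π ^ j)} := by
  have hπj : v.intValuation (π ^ j) = WithZero.exp (-(j : ℤ)) := by
    rw [map_pow, hπ, ← WithZero.exp_nsmul, nsmul_eq_mul, mul_neg_one]
  rw [← Ideal.map_pow]
  refine le_antisymm (Ideal.map_le_iff_le_comap.2 fun a ha => ?_)
    ((Ideal.span_singleton_le_iff_mem _).2 (Ideal.mem_map_of_mem _ ?_))
  · rw [Ideal.mem_comap, Ideal.mem_span_singleton, dvd_iff_valued_le, valued_algebraMap,
      valued_algebraMap, hπj]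
    exact (v.intValuation_le_pow_iff_mem a j).2 ha
  · exact (v.intValuation_le_pow_iff_mem _ j).1 hπj.le

variable {K} in
theorem mem_completedIdeal_pow_iff {j : ℕ} {x : v.adicCompletionIntegers K} :
    x ∈ completedIdeal K v ^ j ↔ Valued.v (x : v.adicCompletion K) ≤ WithZero.exp (-(j : ℤ)) := by
  obtain ⟨π, hπ⟩ := v.intValuation_exists_uniformizer
  rw [completedIdeal_pow_eq_span K hπ, Ideal.mem_span_singleton, dvd_iff_valued_le,
    valued_algebraMap, map_pow, hπ, ← WithZero.exp_nsmul, nsmul_eq_mul, mul_neg_one]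

theorem algebraMap_mem_completedIdeal_pow_iff (j : ℕ) (a : R) :
    algebraMap R (v.adicCompletionIntegers K) a ∈ completedIdeal K v ^ j ↔ a ∈ v.asIdeal ^ j := by
  rw [mem_completedIdeal_pow_iff, valued_algebraMap, v.intValuation_le_pow_iff_mem]

theorem algebraMap_mem_completedIdeal_iff (a : R) :
    algebraMap R (v.adicCompletionIntegers K) a ∈ completedIdeal K v ↔ a ∈ v.asIdeal := by
  simpa only [pow_one] using algebraMap_mem_completedIdeal_pow_iff K v 1 a

theorem completedIdeal_eq_maximalIdeal :
    completedIdeal K v = IsLocalRing.maximalIdeal (v.adicCompletionIntegers K) := by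
  ext x
  have hlt : Valued.v (x : v.adicCompletion K) ≤ WithZero.exp (-((1 : ℕ) : ℤ)) ↔
      Valued.v (x : v.adicCompletion K) < 1 := by
    rw [← WithZero.lt_mul_exp_iff_le WithZero.exp_ne_zero, ← WithZero.exp_add]
    simp
  rw [← pow_one (completedIdeal K v), mem_completedIdeal_pow_iff, hlt,
    IsLocalRing.mem_maximalIdeal, mem_nonunits_iff,
    HeightOneSpectrum.adicCompletionIntegers.isUnit_iff_valued_eq_one]
  exact x.2.lt_iff_ne

instance isPrime_completedIdeal : (completedIdeal K v).IsPrime := by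
  rw [completedIdeal_eq_maximalIdeal]
  infer_instance

theorem isClopen_completedIdeal_pow (j : ℕ) :
    IsClopen ((completedIdeal K v ^ j : Ideal _) : Set (v.adicCompletionIntegers K)) := by
  obtain ⟨π, hπ⟩ := v.intValuation_exists_uniformizer
  let w : v.adicCompletion K := (algebraMap R (v.adicCompletionIntegers K) (π ^ j))
  have hw : Valued.v w = WithZero.exp (-(j : ℤ)) := by
    rw [valued_algebraMap, map_pow, hπ, ← WithZero.exp_nsmul, nsmul_eq_mul, mul_neg_one]
  have hpreimage : ((completedIdeal K v ^ j : Ideal _) : Set (v.adicCompletionIntegers K)) =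
      (fun x : v.adicCompletionIntegers K => (x : v.adicCompletion K) / w) ⁻¹'
        {y | Valued.v y ≤ 1} := by
    ext x
    rw [SetLike.mem_coe, mem_completedIdeal_pow_iff, Set.mem_preimage, Set.mem_ofPred_eq, map_div₀,
      hw, div_le_one₀ WithZero.exp_pos]
  rw [hpreimage]
  exact (Valued.isClopen_integer _).preimage (continuous_subtype_val.div_const w)

end Completion

section LocalSets

theorem continuous_shift {R : Type*} [CommRing R] [TopologicalSpace R] [IsTopologicalRing R] {d : ℕ}
    (b : R) : Continuous (shift (d := d) b) := by
  refine continuous_pi fun j => ?_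
  simp only [shift_apply]
  fun_prop

theorem isClopen_eisensteinSet {R : Type*} [CommRing R] [TopologicalSpace R] {P : Ideal R}
    (hP : IsClopen (P : Set R)) (hP₂ : IsClopen ((P ^ 2 : Ideal R) : Set R)) (d : ℕ) :
    IsClopen (eisensteinSet P d) := by
  have hinter : eisensteinSet P d = ((fun a => a 0) ⁻¹' ((P ^ 2 : Ideal R) : Set R)ᶜ ∩
      (⋂ i, ⋂ (_ : i ≠ Fin.last d), (fun a => a i) ⁻¹' (P : Set R))) ∩
      (fun a => a (Fin.last d)) ⁻¹' (P : Set R)ᶜ := by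
    ext a
    simp [eisensteinSet, and_assoc]
  rw [hinter]
  exact ((hP₂.compl.preimage (continuous_apply 0)).inter
    (isClopen_iInter_of_finite fun i => isClopen_iInter_of_finite fun _ =>
      hP.preimage (continuous_apply i))).inter (hP.compl.preimage (continuous_apply _))

variable {K : Type*} [Field K] [NumberField K] (v : HeightOneSpectrum (𝓞 K))

variable (d : ℕ)

theorem isClopen_localPiece (b : 𝓞 K) : IsClopen (localPiece K d v b) :=
  (isClopen_eisensteinSet (by simpa only [pow_one] using isClopen_completedIdeal_pow K v 1)
    (isClopen_completedIdeal_pow K v 2) d).preimage (continuous_shift _)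

theorem isClopen_finite_shiftedEisensteinSystem :
    IsClopen ((shiftedEisensteinSystem K d).finite v) :=
  isClopen_iUnion_of_finite fun β => isClopen_localPiece v d β.out

variable {d}

theorem mem_localPiece_algebraMap_iff (b : 𝓞 K) (a : Fin (d + 1) → 𝓞 K) :
    (fun i => algebraMap (𝓞 K) (v.adicCompletionIntegers K) (a i)) ∈ localPiece K d v b ↔
      shift b a ∈ eisensteinSet v.asIdeal d := by
  rw [localPiece, Set.mem_preimage, shift_map]
  exact map_mem_eisensteinSet_iff _ (algebraMap_mem_completedIdeal_iff K v)
    (algebraMap_mem_completedIdeal_pow_iff K v 2) _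

variable {v}

theorem localPiece_eq (hd : 2 ≤ d) {b b' : 𝓞 K} (h : b - b' ∈ v.asIdeal) :
    localPiece K d v b = localPiece K d v b' := by
  ext a
  refine shift_mem_eisensteinSet_iff hd ?_
  rwa [← map_sub, algebraMap_mem_completedIdeal_iff]

theorem disjoint_localPiece (hd : 1 ≤ d) {b b' : 𝓞 K} (h : b - b' ∉ v.asIdeal) :
    Disjoint (localPiece K d v b) (localPiece K d v b') := by
  refine Set.disjoint_left.2 fun a ha ha' => h ?_
  rw [← algebraMap_mem_completedIdeal_iff K, map_sub]
  exact sub_mem_of_shift_mem hd ha ha'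

theorem memFinite_iff (hd : 2 ≤ d) (a : Fin (d + 1) → 𝓞 K) :
    (shiftedEisensteinSystem K d).MemFinite v a ↔ ∃ b, shift b a ∈ eisensteinSet v.asIdeal d := by
  simp only [LocalSystem.MemFinite, shiftedEisensteinSystem, Set.mem_iUnion,
    mem_localPiece_algebraMap_iff]
  exact exists_shift_out_mem_eisensteinSet_iff hd a

end LocalSets

section LocalCount

variable {R : Type*} [CommRing R] {d : ℕ}

theorem mem_eisensteinSet_succ_iff {P : Ideal R} {a : Fin (d + 2) → R} :
    a ∈ eisensteinSet P (d + 1) ↔ (a 0 ∈ P ∧ a 0 ∉ P ^ 2) ∧ (∀ i : Fin d, a i.castSucc.succ ∈ P) ∧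
      a (Fin.last d).succ ∉ P := by
  simp only [eisensteinSet, Set.mem_ofPred_eq]
  rw [Fin.forall_fin_succ, Fin.forall_fin_succ']
  simp only [← Fin.succ_last, ne_eq, (Fin.succ_ne_zero _).symm, not_false_eq_true, forall_const,
    Fin.succ_inj, (Fin.castSucc_lt_last _).ne, not_true_eq_false, IsEmpty.forall_iff, and_true]
  tauto

variable [Fintype R]

theorem card_filter_mem_ideal (P : Ideal R) : (Finset.univ.filter (· ∈ P)).card = Nat.card P := by
  rw [Nat.card_eq_fintype_card, Fintype.card_subtype]

theorem filter_mem_eisensteinSet_eq_piFinset (P : Ideal R) :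
    Finset.univ.filter (· ∈ eisensteinSet P (d + 1)) =
      Fintype.piFinset (Fin.cons (Finset.univ.filter (· ∈ P) \ Finset.univ.filter (· ∈ P ^ 2))
        (Fin.snoc (fun _ : Fin d => Finset.univ.filter (· ∈ P)) (Finset.univ.filter (· ∈ P))ᶜ :
          Fin (d + 1) → Finset R) : Fin (d + 2) → Finset R) := by
  ext a
  rw [Finset.mem_filter_univ, Fintype.mem_piFinset, mem_eisensteinSet_succ_iff,
    Fin.forall_fin_succ, Fin.forall_fin_succ']
  simp

theorem card_filter_mem_eisensteinSet (P : Ideal R) :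
    (Finset.univ.filter (· ∈ eisensteinSet P (d + 1))).card =
      (Nat.card P - Nat.card (P ^ 2 : Ideal R)) * (Nat.card P ^ d *
        (Fintype.card R - Nat.card P)) := by
  have hsubset : Finset.univ.filter (· ∈ P ^ 2) ⊆ Finset.univ.filter (· ∈ P) :=
    Finset.monotone_filter_right _ fun x _ hx => Ideal.pow_le_self two_ne_zero hx
  rw [filter_mem_eisensteinSet_eq_piFinset, Fintype.card_piFinset, Fin.prod_univ_succ,
    Fin.prod_univ_castSucc]
  simp only [Fin.cons_zero, Fin.cons_succ, Fin.snoc_castSucc, Fin.snoc_last, Finset.prod_const,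
    Finset.card_univ, Fintype.card_fin, Finset.card_compl, Finset.card_sdiff_of_subset hsubset,
    card_filter_mem_ideal]

end LocalCount

section ShiftedCount

variable {R : Type*} [CommRing R]

theorem card_filter_exists_shift_mem_eisensteinSet [Fintype R] (P : Ideal R) [P.IsPrime] {d : ℕ}
    (hd : 2 ≤ d) :
    (Finset.univ.filter fun a : Fin (d + 1) → R => ∃ b, shift b a ∈ eisensteinSet P d).card =
      Nat.card (R ⧸ P) * (Finset.univ.filter (· ∈ eisensteinSet P d)).card := by
  have hfinite : Fintype (R ⧸ P) := Fintype.ofFinite _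
  let A (γ : R ⧸ P) : Finset (Fin (d + 1) → R) :=
    Finset.univ.filter fun a => shift γ.out a ∈ eisensteinSet P d
  have hunion : (Finset.univ.filter fun a : Fin (d + 1) → R =>
      ∃ b, shift b a ∈ eisensteinSet P d) = Finset.univ.biUnion A := by
    ext a
    simp [A, ← exists_shift_out_mem_eisensteinSet_iff hd]
  have hcard (γ : R ⧸ P) : (A γ).card = (Finset.univ.filter (· ∈ eisensteinSet P d)).card :=
    Finset.card_bijective _ (shift_bijective γ.out) fun a => by simp [A]
  have hdisjoint : ((Finset.univ : Finset (R ⧸ P)) : Set (R ⧸ P)).PairwiseDisjoint A := by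
    intro γ _ γ' _ hne
    refine Finset.disjoint_left.2 fun a ha ha' => hne ?_
    rw [Finset.mem_filter_univ] at ha ha'
    have hsub := sub_mem_of_shift_mem (by omega) ha ha'
    rwa [← Ideal.Quotient.eq, Ideal.Quotient.mk_out, Ideal.Quotient.mk_out] at hsub
  rw [hunion, Finset.card_biUnion hdisjoint, Finset.sum_congr rfl fun γ _ => hcard γ,
    Finset.sum_const, smul_eq_mul, Finset.card_univ, Nat.card_eq_fintype_card]

theorem mk_mem_map_mk_sq_iff (I : Ideal R) (x : R) :
    Ideal.Quotient.mk (I ^ 2) x ∈ I.map (Ideal.Quotient.mk (I ^ 2)) ↔ x ∈ I := by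
  rw [← Ideal.mem_comap, Ideal.comap_map_mk (Ideal.pow_le_self two_ne_zero)]

theorem map_mk_sq_pow_two (I : Ideal R) : I.map (Ideal.Quotient.mk (I ^ 2)) ^ 2 = ⊥ := by
  rw [← Ideal.map_pow, Ideal.map_quotient_self]

theorem shift_mk_mem_eisensteinSet_iff (P : Ideal R) {d : ℕ} (b : R) (a : Fin (d + 1) → R) :
    shift (Ideal.Quotient.mk (P ^ 2) b) (fun i => Ideal.Quotient.mk (P ^ 2) (a i)) ∈
        eisensteinSet (P.map (Ideal.Quotient.mk (P ^ 2))) d ↔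
      shift b a ∈ eisensteinSet P d := by
  rw [shift_map]
  refine map_mem_eisensteinSet_iff _ (mk_mem_map_mk_sq_iff P) (fun x => ?_) _
  rw [map_mk_sq_pow_two, Ideal.mem_bot, Ideal.Quotient.eq_zero_iff_mem]

end ShiftedCount

section ResidueSet

variable {K : Type*} [Field K] [NumberField K] (v : HeightOneSpectrum (𝓞 K))

/-- The coefficient vectors modulo `𝔭²` of the polynomials that are Eisenstein at `𝔭` after a
shift. -/
def residueSet (d : ℕ) : Finset (Fin (d + 1) → 𝓞 K ⧸ v.asIdeal ^ 2) :=
  Finset.univ.filter fun a =>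
    ∃ b, shift b a ∈ eisensteinSet (v.asIdeal.map (Ideal.Quotient.mk (v.asIdeal ^ 2))) d

theorem memFinite_iff_reduce_mem_residueSet {d : ℕ} (hd : 2 ≤ d) (a : Fin (d + 1) → 𝓞 K) :
    (shiftedEisensteinSystem K d).MemFinite v a ↔ reduce v 2 a ∈ residueSet v d := by
  rw [memFinite_iff hd, residueSet, Finset.mem_filter_univ, Ideal.Quotient.mk_surjective.exists]
  exact exists_congr fun b => (shift_mk_mem_eisensteinSet_iff v.asIdeal b a).symm

theorem card_quotient_sq :
    Fintype.card (𝓞 K ⧸ v.asIdeal ^ 2) = Ideal.absNorm v.asIdeal ^ 2 := by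
  rw [← Nat.card_eq_fintype_card, ← map_pow, Ideal.absNorm_apply, Submodule.cardQuot_apply]

theorem card_quotient_sq_quotient_map :
    Nat.card ((𝓞 K ⧸ v.asIdeal ^ 2) ⧸ v.asIdeal.map (Ideal.Quotient.mk (v.asIdeal ^ 2))) =
      Ideal.absNorm v.asIdeal := by
  rw [Ideal.absNorm_apply, Submodule.cardQuot_apply]
  exact Nat.card_congr (DoubleQuot.quotQuotEquivQuotOfLE (Ideal.pow_le_self two_ne_zero)).toEquiv

theorem card_map_mk_sq :
    Nat.card (v.asIdeal.map (Ideal.Quotient.mk (v.asIdeal ^ 2))) = Ideal.absNorm v.asIdeal := by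
  have hcard := Submodule.card_eq_card_quotient_mul_card
    (v.asIdeal.map (Ideal.Quotient.mk (v.asIdeal ^ 2)))
  rw [Nat.card_eq_fintype_card, card_quotient_sq, card_quotient_sq_quotient_map, pow_two] at hcard
  exact (Nat.eq_of_mul_eq_mul_right (absNorm_pos v) hcard).symm

instance isPrime_map_mk_sq : (v.asIdeal.map (Ideal.Quotient.mk (v.asIdeal ^ 2))).IsPrime :=
  Ideal.map_isPrime_of_surjective Ideal.Quotient.mk_surjective
    (by rw [Ideal.mk_ker]; exact Ideal.pow_le_self two_ne_zero)

/-- The Haar measure `(N𝔭 - 1)² / N𝔭 ^ (d + 1)` of the local set of the shifted Eisenstein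
polynomials of degree `d` at `𝔭`. -/
def localDensity (d : ℕ) : ℝ :=
  ((Ideal.absNorm v.asIdeal : ℝ) - 1) ^ 2 / (Ideal.absNorm v.asIdeal : ℝ) ^ (d + 1)

theorem dens_residueSet {d : ℕ} (hd : 2 ≤ d) : ((residueSet v d).dens : ℝ) = localDensity v d := by
  obtain ⟨d, rfl⟩ : ∃ n, d = n + 1 := Nat.exists_eq_succ_of_ne_zero (by omega)
  have hcard_bot : Nat.card (⊥ : Ideal (𝓞 K ⧸ v.asIdeal ^ 2)) = 1 := Nat.card_unique
  have hN : 1 ≤ Ideal.absNorm v.asIdeal := absNorm_pos v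
  have : (Ideal.absNorm v.asIdeal : ℝ) ≠ 0 := mod_cast (absNorm_pos v).ne'
  rw [Finset.nnratCast_dens, residueSet, card_filter_exists_shift_mem_eisensteinSet _ hd,
    card_filter_mem_eisensteinSet, map_mk_sq_pow_two, hcard_bot, card_map_mk_sq,
    card_quotient_sq_quotient_map, Fintype.card_pi, Finset.prod_const, Finset.card_univ,
    Fintype.card_fin, card_quotient_sq, localDensity]
  push_cast [hN, Nat.le_self_pow two_ne_zero]
  field_simp
  ring

theorem two_le_absNorm : (2 : ℝ) ≤ Ideal.absNorm v.asIdeal := by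
  exact_mod_cast (below_prime v).two_le.trans (below_le_absNorm v)

theorem localDensity_pos (d : ℕ) : 0 < localDensity v d := by
  have hN := two_le_absNorm v
  exact div_pos (pow_pos (by linarith) 2) (pow_pos (by linarith) (d + 1))

theorem localDensity_le {d : ℕ} (hd : 3 ≤ d) :
    localDensity v d ≤ ((Ideal.absNorm v.asIdeal : ℝ) ^ 2)⁻¹ := by
  have hN := two_le_absNorm v
  rw [localDensity]
  generalize (Ideal.absNorm v.asIdeal : ℝ) = N at hN
  have : 0 < N := by linarith
  rw [← one_div, div_le_div_iff₀ (by positivity) (by positivity), one_mul]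
  calc (N - 1) ^ 2 * N ^ 2 ≤ N ^ 2 * N ^ 2 := by gcongr <;> linarith
    _ = N ^ 4 := by ring
    _ ≤ N ^ (d + 1) := pow_le_pow_right₀ (by linarith) (by omega)

theorem localDensity_le_one {d : ℕ} (hd : 3 ≤ d) : localDensity v d ≤ 1 :=
  (localDensity_le v hd).trans (inv_le_one_of_one_le₀ (one_le_pow₀ (by
    linarith [two_le_absNorm v])))

theorem summable_localDensity (K : Type*) [Field K] [NumberField K] {d : ℕ} (hd : 3 ≤ d) :
    Summable fun v : HeightOneSpectrum (𝓞 K) => localDensity v d :=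
  (summable_inv_absNorm_sq K).of_nonneg_of_le (fun v => (localDensity_pos v d).le)
    fun v => localDensity_le v hd

theorem nonempty_heightOneSpectrum (K : Type*) [Field K] [NumberField K] :
    Nonempty (HeightOneSpectrum (𝓞 K)) :=
  let ⟨P, hP, hPprime⟩ := Ring.not_isField_iff_exists_prime.1 (RingOfIntegers.not_isField K)
  ⟨⟨P, hPprime, hP⟩⟩

end ResidueSet

section LargePrimes

variable {K : Type*} [Field K] [NumberField K] {d : ℕ}

theorem coeff_powerDefect_mem_of_memFinite (hd : 2 ≤ d) {v : HeightOneSpectrum (𝓞 K)}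
    {a : Fin (d + 1) → 𝓞 K} (h : (shiftedEisensteinSystem K d).MemFinite v a) (j : ℕ) :
    (powerDefect d (toPoly a)).coeff j ∈ v.asIdeal :=
  let ⟨_, hb⟩ := (memFinite_iff hd a).1 h
  coeff_powerDefect_mem (by omega) hb.2.1 j

theorem last_notMem_of_memFinite (hd : 2 ≤ d) {v : HeightOneSpectrum (𝓞 K)}
    {a : Fin (d + 1) → 𝓞 K} (h : (shiftedEisensteinSystem K d).MemFinite v a) :
    a (Fin.last d) ∉ v.asIdeal := by
  obtain ⟨b, hb⟩ := (memFinite_iff hd a).1 h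
  simpa only [shift_last] using hb.2.2

theorem exists_coeff_powerDefect_ne_zero (hd : 2 ≤ d) {v : HeightOneSpectrum (𝓞 K)}
    {a : Fin (d + 1) → 𝓞 K} (h : (shiftedEisensteinSystem K d).MemFinite v a) :
    ∃ j ≤ d, (powerDefect d (toPoly a)).coeff j ≠ 0 := by
  obtain ⟨b, hb⟩ := (memFinite_iff hd a).1 h
  have hdefect : powerDefect d (toPoly a) ≠ 0 :=
    powerDefect_ne_zero_of_shift_mem hd (Nat.cast_ne_zero.2 (by omega)) hb
  exact ⟨_, natDegree_powerDefect_le (natDegree_toPoly_le a), leadingCoeff_ne_zero.2 hdefect⟩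

variable (E : IntegralBasis K) {β : ℝ}

theorem exists_encard_large_le (hd : 2 ≤ d) (hβ : 0 < β) : ∃ c : ℕ, ∀ H : ℕ, 1 ≤ H →
    ∀ a ∈ box E (d + 1) H, {v : HeightOneSpectrum (𝓞 K) |
      (H : ℝ) ^ β < below v ∧ (shiftedEisensteinSystem K d).MemFinite v a}.encard ≤ c := by
  obtain ⟨C, hC⟩ := exists_absNorm_coeff_powerDefect_le E (d := d) (by omega)
  obtain ⟨c, hc⟩ := exists_encard_le_of_absNorm_le K hβ C (d * Module.finrank ℚ K)
  refine ⟨c, fun H hH a ha => ?_⟩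
  by_cases hex : ∃ v, (shiftedEisensteinSystem K d).MemFinite v a
  · obtain ⟨v, hv⟩ := hex
    obtain ⟨j, hj, hj₀⟩ := exists_coeff_powerDefect_ne_zero hd hv
    refine (Set.encard_le_encard fun w hw => ?_).trans (hc H hH _ hj₀ (hC H hH a ha j hj))
    exact ⟨hw.1, coeff_powerDefect_mem_of_memFinite hd hw.2 j⟩
  · have hempty : {v : HeightOneSpectrum (𝓞 K) |
        (H : ℝ) ^ β < below v ∧ (shiftedEisensteinSystem K d).MemFinite v a} = ∅ :=
      Set.eq_empty_of_forall_notMem fun v hv => hex ⟨v, hv.2⟩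
    simp only [hempty, Set.encard_empty, zero_le]

theorem pow_mul_last_pow_notMem (hd : 2 ≤ d) {v : HeightOneSpectrum (𝓞 K)} {a : Fin (d + 1) → 𝓞 K}
    (h : (shiftedEisensteinSystem K d).MemFinite v a) (hv : d < below v) :
    (d : 𝓞 K) ^ d * a (Fin.last d) ^ (d - 1) ∉ v.asIdeal := by
  have := v.isPrime
  refine this.mul_notMem (fun hmem => ?_) fun hmem => ?_
  · exact natCast_notMem_asIdeal (by omega) hv (this.mem_of_pow_mem _ hmem)
  · exact last_notMem_of_memFinite hd h (this.mem_of_pow_mem _ hmem)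

theorem tendsto_boxRatio_large (hd : 3 ≤ d) (hβ : 0 < β) :
    Tendsto (fun H : ℕ => boxRatio E {a | ∃ v : HeightOneSpectrum (𝓞 K),
      (H : ℝ) ^ β < below v ∧ (shiftedEisensteinSystem K d).MemFinite v a} H) atTop (𝓝 0) := by
  obtain ⟨C, hC⟩ := exists_absNorm_coeff_powerDefect_le E (d := d) (by omega)
  let i : Fin (d + 1) := ⟨d - 3, by omega⟩
  let j : Fin (d + 1) := ⟨d - 2, by omega⟩
  have hi : (i : ℕ) + 1 < d := show d - 3 + 1 < d by omega
  have hj : (j : ℕ) + 1 < d := show d - 2 + 1 < d by omega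
  have hji : (j : ℕ) ≠ i := show d - 2 ≠ d - 3 by omega
  have hpair := tendsto_boxRatio_exists_mem E hβ (i := i) (j := j)
    (F := fun a => (powerDefect d (toPoly a)).coeff j)
    (G := fun a => (powerDefect d (toPoly a)).coeff i)
    (D := fun a => (d : 𝓞 K) ^ d * a (Fin.last d) ^ (d - 1))
    (fun H hH a ha => hC H hH a ha j (by omega))
    (fun a x => coeff_powerDefect_update_of_ne a hi hji x)
    (fun a x y => coeff_powerDefect_update_sub a hj x y)
    (fun a x y => coeff_powerDefect_update_sub a hi x y)
  have hlarge : ∀ᶠ H : ℕ in atTop, (d : ℝ) ≤ (H : ℝ) ^ β :=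
    ((tendsto_rpow_atTop hβ).comp tendsto_natCast_atTop_atTop).eventually_ge_atTop _
  refine squeeze_zero' (Eventually.of_forall fun H => boxRatio_nonneg E _ H) ?_ hpair
  filter_upwards [hlarge] with H hH
  refine boxRatio_mono E ?_ H
  rintro a ⟨v, hv, hmem⟩
  refine ⟨v, hv, ?_, ?_, ?_⟩
  · exact coeff_powerDefect_mem_of_memFinite (by omega) hmem j
  · exact coeff_powerDefect_mem_of_memFinite (by omega) hmem i
  · exact pow_mul_last_pow_notMem (by omega) hmem (mod_cast hH.trans_lt hv)

theorem isCongruenceSieve_shiftedEisensteinSystem (hd : 3 ≤ d) :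
    (shiftedEisensteinSystem K d).IsCongruenceSieve E 2 fun v => localDensity v d where
  infinite_eq_empty := rfl
  exponent_ne_zero := two_ne_zero
  exists_residues v := ⟨residueSet v d, dens_residueSet v (by omega),
    memFinite_iff_reduce_mem_residueSet v (by omega)⟩
  summable := summable_localDensity K hd
  encard_large_le _ hβ := exists_encard_large_le E (by omega) hβ
  tendsto_large _ hβ := tendsto_boxRatio_large E hd hβ

theorem compl_shiftedEisenstein (hd : 2 ≤ d) :
    (shiftedEisenstein K d)ᶜ = {a | (shiftedEisensteinSystem K d).places a = ∅} := by
  ext a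
  simp only [Set.mem_compl_iff, Set.mem_ofPred_eq, Set.eq_empty_iff_forall_notMem, Option.forall,
    shiftedEisenstein, ← memFinite_iff hd, not_exists]
  exact ⟨fun h => ⟨id, h⟩, fun h => h.2⟩

end LargePrimes

end LocalToGlobal

end

theorem corollary4p10 (K : Type*) [Field K] [NumberField K] (d : ℕ) (hd : 3 ≤ d) :
    -- the union defining the local sets is disjoint and independent of representatives
    (∀ (v : HeightOneSpectrum (𝓞 K)) (b b' : 𝓞 K),
      (b - b' ∈ v.asIdeal → LocalToGlobal.localPiece K d v b = LocalToGlobal.localPiece K d v b') ∧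
      (b - b' ∉ v.asIdeal →
        Disjoint (LocalToGlobal.localPiece K d v b) (LocalToGlobal.localPiece K d v b'))) ∧
    -- the system corresponds to the set of shifted Eisenstein polynomials
    (∀ E : LocalToGlobal.IntegralBasis K,
      (LocalToGlobal.shiftedEisensteinSystem K d).CorrespondsTo E
        (LocalToGlobal.shiftedEisenstein K d)) ∧
    -- the hypotheses of the principle for the `n`-th moment hold for all `n`
    (∀ (E : LocalToGlobal.IntegralBasis K) (n : ℕ), 1 ≤ n →
      (LocalToGlobal.shiftedEisensteinSystem K d).MomentConditions E n) ∧
    -- density, mean, restricted mean and restricted variance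
    let s : HeightOneSpectrum (𝓞 K) → ℝ := fun v =>
      ((Ideal.absNorm v.asIdeal : ℝ) - 1) ^ 2 / (Ideal.absNorm v.asIdeal : ℝ) ^ (d + 1)
    let ρ : ℝ := 1 - ∏' v, (1 - s v)
    let μ : ℝ := ∑' v, s v
    let μT : ℝ := ρ⁻¹ * μ
    Summable s ∧ Summable (fun v => s v ^ 2) ∧ Multipliable (fun v => 1 - s v) ∧ 0 < ρ ∧
    ∀ E : LocalToGlobal.IntegralBasis K,
      LocalToGlobal.HasDensity E (LocalToGlobal.shiftedEisenstein K d) ρ ∧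
      (LocalToGlobal.shiftedEisensteinSystem K d).HasMoment E 1 μ ∧
      (LocalToGlobal.shiftedEisensteinSystem K d).HasRestrictedMoment E
        (LocalToGlobal.shiftedEisenstein K d) 1 μT ∧
      (LocalToGlobal.shiftedEisensteinSystem K d).HasRestrictedVariance E
        (LocalToGlobal.shiftedEisenstein K d)
        (1 / ρ * (μ ^ 2 - ∑' v, s v ^ 2 + μ) - 2 * μT / ρ * μ + μT ^ 2) := by
  open LocalToGlobal in
  have hs := summable_localDensity K hd
  have hs₀ (v : HeightOneSpectrum (𝓞 K)) : 0 ≤ localDensity v d := (localDensity_pos v d).le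
  obtain ⟨v⟩ := nonempty_heightOneSpectrum K
  have hρ : 0 < 1 - ∏' v : HeightOneSpectrum (𝓞 K), (1 - localDensity v d) :=
    sub_pos.2 (tprod_one_sub_lt_one hs hs₀ (localDensity_le_one · hd) (localDensity_pos v d))
  have hT := compl_shiftedEisenstein (K := K) (d := d) (by omega)
  have hU (E : IntegralBasis K) := isCongruenceSieve_shiftedEisensteinSystem E hd
  have hdens (E : IntegralBasis K) := (hU E).hasDensity hT
  refine ⟨fun v b b' => ⟨localPiece_eq (by omega), disjoint_localPiece (by omega)⟩,
    fun E => (hU E).correspondsTo hT,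
    fun E n hn => (hU E).momentConditions (isClopen_finite_shiftedEisensteinSystem · d)
      (Nat.one_le_iff_ne_zero.1 hn),
    hs, summable_sq hs hs₀, multipliable_one_sub hs, hρ, fun E =>
    ⟨hdens E, (hU E).hasMoment_one,
      (hU E).hasRestrictedMoment hT hρ.ne' (hdens E) one_ne_zero (hU E).hasMoment_one,
      (hU E).hasRestrictedVariance hT hρ.ne' (hdens E) (hU E).hasMoment_one
        (hU E).hasMoment_two⟩⟩
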